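/- Let $M$ be a free $\mathbb Z$-module of finite rank equipped with a finite reduced root datum (a finite set of roots $\alpha\in M$ with coroots $\alpha^\vee\in M^\vee$), let $W$ be its Weyl group, generated by the reflections $s_\alpha(\lambda)=\lambda-\alpha^\vee(\lambda)\alpha$, and fix a basis of simple roots, hence a length function on $W$ and a longest element $w_0$, of length $N$. Let $\mathfrak t\ge 0$ be the torsion index of the root datum: $\Delta_{w_0}(S^N_{\mathbb Z}(M))=\mathfrak t\,\mathbb Z$, where $\Delta_{w_0}$ is the composition of the classical operators $u\mapsto (u-s_\alpha(u))/\alpha$ on the symmetric algebra $S^*_{\mathbb Z}(M)$ along a reduced decomposition of $w_0$ into simple reflections. Let $R$ be a commutative ring and $F$ a one-dimensional commutative formal group law over $R$. Let $R[[x_M]]$ be the completion of the polynomial ring $R[x_\lambda,\ \lambda\in M]$ at the ideal generated by all the variables, and let the formal group ring $R[[M]]_F$ be the quotient of $R[[x_M]]$ by the closure of the ideal generated by $x_0$ and all $x_{\lambda+\mu}-F(x_\lambda,x_\mu)$. Let $\varepsilon:R[[M]]_F\to R$, $x_\lambda\mapsto 0$, be the augmentation and $\mathcal I_F=\ker\varepsilon$;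 the group $W$ acts on $R[[M]]_F$ by $w(x_\lambda)=x_{w(\lambda)}$. Suppose that $\mathfrak t$ is invertible in $R$ and that $R$ has no $2$-torsion. For a root $\alpha$ let $\Delta_\alpha$ be the $R$-linear operator on $R[[M]]_F$ given by $\Delta_\alpha(u)=(u-s_\alpha(u))/x_\alpha$ (here $x_\alpha$ is a nonzerodivisor that divides every $u-s_\alpha(u)$). Let $\mathcal D(M)_F$ be the algebra of $R$-linear endomorphisms of $R[[M]]_F$ generated by the $\Delta_\alpha$ for all roots $\alpha$ and by the multiplications by elements of $R[[M]]_F$, let $\varepsilon\mathcal D(M)_F$ be the $R$-module of linear forms $\varepsilon\circ D$ with $D\in\mathcal D(M)_F$, let $\mathcal H(M)_F=\operatorname{Hom}_R(\varepsilon\mathcal D(M)_F,R)$, and let the characteristic map $\mathfrak c: R[[M]]_F\to\mathcal H(M)_F$ send $u$ to the evaluation at $u$. Then the kernel of $\mathfrak c$ is the ideal of $R[[M]]_F$ generated by the $W$-invariant elements of $\mathcal I_F$. -/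

import Mathlib

/-! ## Formal power series with finitely many monomials in each degree -/

/-- The completion `R⟦x_S⟧` of the polynomial ring `R[x_s, s ∈ S]` at the kernel of the augmentation
`x_s ↦ 0`, realised as the ring of formal power series that have only finitely many nonzero
coefficients in each total degree (for infinite `S` this is smaller than `MvPowerSeries S R`). -/
def CompletedPoly (S R : Type*) [CommRing R] : Subalgebra R (MvPowerSeries S R) where
  carrier := {f | ∀ n : ℕ, {d : S →₀ ℕ | d.degree = n ∧ MvPowerSeries.coeff d f ≠ 0}.Finite}
  mul_mem' := by
    classical
    intro f g hf hg n
    have hF := Set.Finite.biUnion (Set.finite_le_nat n) (fun i _ => hf i)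
    have hG := Set.Finite.biUnion (Set.finite_le_nat n) (fun i _ => hg i)
    refine (Set.Finite.image2 (· + ·) hF hG).subset ?_
    rintro d ⟨hd, hne⟩
    rw [MvPowerSeries.coeff_mul] at hne
    obtain ⟨p, hp, hpne⟩ := Finset.exists_ne_zero_of_sum_ne_zero hne
    rw [Finset.HasAntidiagonal.mem_antidiagonal] at hp
    have hdeg : p.1.degree + p.2.degree = n := by rw [← hd, ← hp, map_add]
    refine ⟨p.1, ?_, p.2, ?_, hp⟩
    · simp only [Set.mem_iUnion]
      exact ⟨p.1.degree, by simp only [Set.mem_ofPred_eq]; omega, rfl, left_ne_zero_of_mul hpne⟩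
    · simp only [Set.mem_iUnion]
      exact ⟨p.2.degree, by simp only [Set.mem_ofPred_eq]; omega, rfl, right_ne_zero_of_mul hpne⟩
  add_mem' := by
    intro f g hf hg n
    refine ((hf n).union (hg n)).subset ?_
    rintro d ⟨hd, hne⟩
    by_contra hcon
    simp only [Set.mem_union, Set.mem_ofPred_eq, not_or, not_and, not_not] at hcon
    exact hne (by rw [map_add, hcon.1 hd, hcon.2 hd, add_zero])
  algebraMap_mem' := by
    classical
    intro r n
    refine (Set.finite_singleton (0 : S →₀ ℕ)).subset ?_
    rintro d ⟨_, hne⟩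
    by_contra hd
    refine hne ?_
    rw [MvPowerSeries.algebraMap_apply, MvPowerSeries.coeff_C, if_neg (by simpa using hd)]

namespace CompletedPoly

open MvPowerSeries

/-- The variable `x_s`. -/
noncomputable def var {S : Type*} (R : Type*) [CommRing R] (s : S) : CompletedPoly S R :=
  ⟨X s, by
    classical
    intro n
    refine (Set.finite_singleton (Finsupp.single s 1)).subset ?_
    rintro d ⟨_, hne⟩
    by_contra hd
    exact hne (by rw [coeff_X, if_neg (by simpa using hd)])⟩

/-- The series `G(x_s, x_t)` for a power series `G` in two variables. -/
noncomputable def evalTwo {S R : Type*} [CommRing R] (G : MvPowerSeries (Fin 2) R) (s t : S) :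
    CompletedPoly S R :=
  ⟨G.subst ![(X s : MvPowerSeries S R), X t], by
    classical
    intro n
    refine (((Set.finite_le_nat n).prod (Set.finite_le_nat n)).image
      (fun p : ℕ × ℕ => Finsupp.single s p.1 + Finsupp.single t p.2)).subset ?_
    rintro d ⟨hdeg, hne⟩
    rw [coeff_subst HasSubst.X_X] at hne
    obtain ⟨e, he⟩ := not_forall.mp (fun h => hne (finsum_eq_zero_of_forall_eq_zero h))
    have hm : (e.prod fun i k => (![(X s : MvPowerSeries S R), X t] i) ^ k) =
        monomial (Finsupp.single s (e 0) + Finsupp.single t (e 1)) 1 := by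
      rw [Finsupp.prod_fintype _ _ (by simp), Fin.prod_univ_two]
      simp [X_pow_eq, monomial_mul_monomial]
    rw [hm, coeff_monomial] at he
    have hd : d = Finsupp.single s (e 0) + Finsupp.single t (e 1) := by
      by_contra hcon
      simp [hcon] at he
    have h2 : e 0 + e 1 = n := by rw [← hdeg, hd]; simp
    exact ⟨(e 0, e 1), ⟨by simp only [Set.mem_ofPred_eq]; omega,
      by simp only [Set.mem_ofPred_eq]; omega⟩, hd.symm⟩⟩

/-- The ideal of series of valuation at least `n`. These ideals form a fundamental system of
neighbourhoods of `0` in the completion. -/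
noncomputable def valuationIdeal (S R : Type*) [CommRing R] (n : ℕ) : Ideal (CompletedPoly S R) where
  carrier := {f | ∀ d : S →₀ ℕ, d.degree < n → coeff d (f : MvPowerSeries S R) = 0}
  zero_mem' := by intro d _; simp
  add_mem' := by
    intro f g hf hg d hd
    simp [hf d hd, hg d hd]
  smul_mem' := by
    classical
    intro c f hf d hd
    rw [smul_eq_mul, MulMemClass.coe_mul, coeff_mul]
    refine Finset.sum_eq_zero fun p hp => ?_
    rw [Finset.HasAntidiagonal.mem_antidiagonal] at hp
    have : p.1.degree + p.2.degree = d.degree := by rw [← hp, map_add]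
    rw [hf p.2 (by omega), mul_zero]

/-- The topological closure of an ideal. -/
noncomputable def closure {S R : Type*} [CommRing R] (J : Ideal (CompletedPoly S R)) :
    Ideal (CompletedPoly S R) :=
  ⨅ n : ℕ, J ⊔ valuationIdeal S R n

/-- Renaming the variables along a bijection. -/
noncomputable def rename {S T : Type*} (R : Type*) [CommRing R] (e : S ≃ T) :
    CompletedPoly S R →ₐ[R] CompletedPoly T R :=
  ((MvPowerSeries.rename (R := R) e).comp (CompletedPoly S R).val).codRestrict _ (by
    intro f n
    refine ((f.2 n).image (Finsupp.mapDomain e)).subset ?_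
    rintro d ⟨hd, hne⟩
    rw [AlgHom.comp_apply, coeff_rename] at hne
    obtain ⟨c, hc, hcne⟩ := Finset.exists_ne_zero_of_sum_ne_zero hne
    have hc' : Finsupp.mapDomain e c = d := by simpa using hc
    refine ⟨c, ⟨?_, hcne⟩, hc'⟩
    rw [← hd, ← hc', Finsupp.degree_mapDomain])

/-- The augmentation `R⟦x_S⟧ → R`, sending a series to its constant coefficient. -/
noncomputable def aug (S R : Type*) [CommRing R] : CompletedPoly S R →ₐ[R] R where
  toFun f := constantCoeff (f : MvPowerSeries S R)
  map_one' := by simp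
  map_mul' := by simp
  map_zero' := by simp
  map_add' := by simp
  commutes' r := by simp [MvPowerSeries.algebraMap_apply]

theorem rename_var {S T R : Type*} [CommRing R] (e : S ≃ T) (s : S) :
    rename R e (var R s) = var R (e s) :=
  Subtype.ext (rename_X _ s)

theorem rename_evalTwo {S T R : Type*} [CommRing R] (e : S ≃ T) (G : MvPowerSeries (Fin 2) R)
    (s t : S) : rename R e (evalTwo G s t) = evalTwo G (e s) (e t) := by
  refine Subtype.ext ?_
  change MvPowerSeries.rename e (G.subst ![X s, X t]) = G.subst ![X (e s), X (e t)]
  rw [rename_eq_subst, subst_comp_subst_apply HasSubst.X_X (HasSubst.X_comp _)]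
  congr 1
  funext i
  fin_cases i <;> simp [subst_X (HasSubst.X_comp _)]

theorem rename_mem_valuationIdeal {S T R : Type*} [CommRing R] (e : S ≃ T) {n : ℕ}
    {f : CompletedPoly S R} (hf : f ∈ valuationIdeal S R n) :
    rename R e f ∈ valuationIdeal T R n := by
  intro d hd
  change coeff d (MvPowerSeries.rename e (f : MvPowerSeries S R)) = 0
  rw [coeff_rename]
  refine Finset.sum_eq_zero fun c hc => hf c ?_
  have hc' : Finsupp.mapDomain e c = d := by simpa using hc
  rwa [← Finsupp.degree_mapDomain e c, hc']

end CompletedPoly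

/-! ## The formal group ring -/

/-- The ideal generated by `x_0` and the elements `x_{λ+μ} - F(x_λ, x_μ)`. -/
noncomputable def FormalGroup.relIdeal {R : Type*} [CommRing R] (F : FormalGroup R) (M : Type*)
    [AddCommGroup M] : Ideal (CompletedPoly M R) :=
  Ideal.span ({CompletedPoly.var R 0} ∪ {f | ∃ l m : M,
    f = CompletedPoly.var R (l + m) - CompletedPoly.evalTwo F.toPowerSeries l m})

/-- The formal group ring `R⟦M⟧_F`: the quotient of `R⟦x_M⟧` by the closure of the ideal generated
by `x_0` and all `x_{λ+μ} - F(x_λ, x_μ)`. -/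
def FormalGroupRing {R : Type*} [CommRing R] (M : Type*) [AddCommGroup M]
    (F : FormalGroup R) : Type _ :=
  CompletedPoly M R ⧸ CompletedPoly.closure (F.relIdeal M)

namespace FormalGroupRing

variable {R M M' : Type*} [CommRing R] [AddCommGroup M] [AddCommGroup M']

noncomputable instance (F : FormalGroup R) : CommRing (FormalGroupRing M F) :=
  inferInstanceAs (CommRing (CompletedPoly M R ⧸ CompletedPoly.closure (F.relIdeal M)))

noncomputable instance (F : FormalGroup R) : Algebra R (FormalGroupRing M F) :=
  inferInstanceAs (Algebra R (CompletedPoly M R ⧸ CompletedPoly.closure (F.relIdeal M)))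

/-- The quotient map `R⟦x_M⟧ → R⟦M⟧_F`. -/
noncomputable def mk (F : FormalGroup R) : CompletedPoly M R →ₐ[R] FormalGroupRing M F :=
  Ideal.Quotient.mkₐ R (CompletedPoly.closure (F.relIdeal M))

/-- The class of `x_λ`. -/
noncomputable def x (F : FormalGroup R) (l : M) : FormalGroupRing M F :=
  mk F (CompletedPoly.var R l)

theorem relIdeal_le_comap_rename (F : FormalGroup R) (e : M ≃+ M') :
    F.relIdeal M ≤ (F.relIdeal M').comap (CompletedPoly.rename R e.toEquiv) := by
  refine Ideal.span_le.mpr ?_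
  rintro f (hf | ⟨l, m, rfl⟩)
  · rw [Set.mem_singleton_iff] at hf
    subst hf
    refine Ideal.subset_span (Or.inl ?_)
    rw [Set.mem_singleton_iff, CompletedPoly.rename_var]
    exact congrArg _ (map_zero e)
  · refine Ideal.subset_span (Or.inr ⟨e l, e m, ?_⟩)
    rw [map_sub, CompletedPoly.rename_var, CompletedPoly.rename_evalTwo]
    exact congrArg (fun t => CompletedPoly.var R t - _) (map_add e l m)

theorem closure_le_comap_rename (F : FormalGroup R) (e : M ≃+ M') :
    CompletedPoly.closure (F.relIdeal M) ≤
      (CompletedPoly.closure (F.relIdeal M')).comap (CompletedPoly.rename R e.toEquiv) := by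
  intro f hf
  rw [Ideal.mem_comap, CompletedPoly.closure, Ideal.mem_iInf]
  intro n
  rw [CompletedPoly.closure, Ideal.mem_iInf] at hf
  rw [← Ideal.mem_comap]
  refine (sup_le ((relIdeal_le_comap_rename F e).trans (Ideal.comap_mono le_sup_left)) ?_) (hf n)
  exact fun g hg => Ideal.mem_sup_right (CompletedPoly.rename_mem_valuationIdeal e.toEquiv hg)

/-- Functoriality in `M`, for isomorphisms: the algebra map with `x_λ ↦ x_{e(λ)}`. -/
noncomputable def map (F : FormalGroup R) (e : M ≃+ M') :
    FormalGroupRing M F →ₐ[R] FormalGroupRing M' F :=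
  Ideal.quotientMapₐ (CompletedPoly.closure (F.relIdeal M')) (CompletedPoly.rename R e.toEquiv) (closure_le_comap_rename F e)

theorem closure_le_ker_aug (F : FormalGroup R) (f : CompletedPoly M R)
    (hf : f ∈ CompletedPoly.closure (F.relIdeal M)) : CompletedPoly.aug M R f = 0 := by
  rw [CompletedPoly.closure, Ideal.mem_iInf] at hf
  have h : F.relIdeal M ⊔ CompletedPoly.valuationIdeal M R 1 ≤
      RingHom.ker (CompletedPoly.aug M R) := by
    refine sup_le (Ideal.span_le.mpr ?_) ?_
    · rintro f (hf | ⟨l, m, rfl⟩)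
      · rw [Set.mem_singleton_iff] at hf
        subst hf
        exact MvPowerSeries.constantCoeff_X _
      · change CompletedPoly.aug M R _ = 0
        rw [map_sub]
        change MvPowerSeries.constantCoeff (MvPowerSeries.X (l + m)) -
          MvPowerSeries.constantCoeff (F.toPowerSeries.subst ![MvPowerSeries.X l,
            MvPowerSeries.X m]) = (0 : R)
        rw [MvPowerSeries.constantCoeff_X, MvPowerSeries.constantCoeff_subst_eq_zero
          MvPowerSeries.HasSubst.X_X _ F.zero_constantCoeff, sub_zero]
        intro i
        fin_cases i <;> simp
    · intro g hg
      exact hg 0 (by simp)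
  exact h (hf 1)

/-- The augmentation `ε : R⟦M⟧_F → R`, sending every `x_λ` to `0`. -/
noncomputable def aug (M : Type*) [AddCommGroup M] (F : FormalGroup R) :
    FormalGroupRing M F →ₐ[R] R :=
  Ideal.Quotient.liftₐ (CompletedPoly.closure (F.relIdeal M)) (CompletedPoly.aug M R) (closure_le_ker_aug F)

/-- The augmentation ideal `I_F`. -/
noncomputable def augIdeal (M : Type*) [AddCommGroup M] (F : FormalGroup R) :
    Ideal (FormalGroupRing M F) :=
  RingHom.ker (aug M F)

end FormalGroupRing

/-! ## Divided differences -/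

open Classical in
/-- The linear operator `u ↦ (u - s(u)) / x` on an algebra `A`. It is used for `x` a nonzerodivisor
that divides every `u - s(u)`; then it is the only operator `T` with `x * T(u) = u - s(u)`. -/
noncomputable def dividedDifference {R A : Type*} [CommRing R] [CommRing A] [Algebra R A]
    (s : A →ₐ[R] A) (x : A) : Module.End R A :=
  if h : ∃ T : Module.End R A, ∀ u, x * T u = u - s u then h.choose else 0

theorem mul_dividedDifference {R A : Type*} [CommRing R] [CommRing A] [Algebra R A]
    (s : A →ₐ[R] A) {x : A} (hx : IsLeftRegular x) (hd : ∀ u, x ∣ u - s u) (u : A) :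
    x * dividedDifference s x u = u - s u := by
  have h : ∃ T : Module.End R A, ∀ u, x * T u = u - s u := by
    choose f hf using hd
    refine ⟨⟨⟨f, fun a b => hx ?_⟩, fun r a => hx ?_⟩, fun u => (hf u).symm⟩
    · change x * f (a + b) = x * (f a + f b)
      rw [mul_add, ← hf, ← hf, ← hf, map_add]
      ring
    · change x * f (r • a) = x * (r • f a)
      rw [mul_smul_comm, ← hf, ← hf, map_smul, smul_sub]
  rw [dividedDifference, dif_pos h]
  exact h.choose_spec u

namespace RootPairing

variable {ι M N : Type*} [AddCommGroup M] [AddCommGroup N] (P : RootDatum ι M N)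

/-! ## The torsion index -/

/-- The product `s_{i_1} ⋯ s_{i_l}` of simple reflections. -/
noncomputable def wordProd {P : RootDatum ι M N} (b : P.Base) (I : List b.support) : P.weylGroup :=
  (I.map fun i => weylGroup.ofIdx P (i : ι)).prod

/-- The length of an element of the Weyl group with respect to the simple reflections. -/
noncomputable def weylLength {P : RootDatum ι M N} (b : P.Base) (w : P.weylGroup) : ℕ :=
  sInf {n | ∃ I : List b.support, I.length = n ∧ wordProd b I = w}

/-- `I` is a reduced decomposition of the longest element of the Weyl group. -/
def IsReducedLongest {P : RootDatum ι M N} (b : P.Base) (I : List b.support) : Prop :=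
  I.length = weylLength b (wordProd b I) ∧
    ∀ w : P.weylGroup, weylLength b w ≤ weylLength b (wordProd b I)

/-- The reflection `s_α` on the symmetric algebra `S^*(M)`. -/
noncomputable def symReflection (i : ι) : SymmetricAlgebra ℤ M →ₐ[ℤ] SymmetricAlgebra ℤ M :=
  SymmetricAlgebra.lift (SymmetricAlgebra.ι ℤ M ∘ₗ (P.reflection i).toLinearMap)

/-- The classical operator `Δ_α(u) = (u - s_α(u)) / α` on the symmetric algebra `S^*(M)`. -/
noncomputable def symDelta (i : ι) : Module.End ℤ (SymmetricAlgebra ℤ M) :=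
  dividedDifference (P.symReflection i) (SymmetricAlgebra.ι ℤ M (P.root i))

/-- The image of `Δ_{w₀} : S^N(M) → S^0(M) = ℤ`, where `N` is the length of the longest element
`w₀` and `Δ_{w₀} = Δ_{i_1} ∘ ⋯ ∘ Δ_{i_N}` for any reduced decomposition `(i_1, …, i_N)` of `w₀`
(the choice does not matter). -/
def torsionSubgroup {P : RootDatum ι M N} (b : P.Base) : AddSubgroup ℤ :=
  AddSubgroup.closure {t : ℤ | ∃ I : List b.support, IsReducedLongest b I ∧
    ∃ a ∈ LinearMap.range (SymmetricAlgebra.ι ℤ M) ^ I.length,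
      (I.map fun i => P.symDelta (i : ι)).prod a = algebraMap ℤ (SymmetricAlgebra ℤ M) t}

/-- The torsion index: the nonnegative integer `t` such that `Δ_{w₀}(S^N(M)) = tℤ`. -/
noncomputable def torsionIndex {P : RootDatum ι M N} (b : P.Base) : ℕ :=
  (torsionSubgroup b).index

/-! ## The characteristic map -/

variable {R : Type*} [CommRing R] (F : FormalGroup R)

/-- The action of an element of the Weyl group on `R⟦M⟧_F`. -/
noncomputable def weylAct (w : P.weylGroup) : FormalGroupRing M F →ₐ[R] FormalGroupRing M F :=
  FormalGroupRing.map F (DistribMulAction.toAddEquiv M w)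

/-- The operator `Δ_α(u) = (u - s_α(u)) / x_α` on `R⟦M⟧_F`. -/
noncomputable def delta (i : ι) : Module.End R (FormalGroupRing M F) :=
  dividedDifference (P.weylAct F (weylGroup.ofIdx P i)) (FormalGroupRing.x F (P.root i))

/-- The algebra `D(M)_F` of `R`-linear endomorphisms of `R⟦M⟧_F` generated by the `Δ_α` for all
roots `α` and by the multiplications by elements of `R⟦M⟧_F`. -/
noncomputable def operatorAlgebra : Subalgebra R (Module.End R (FormalGroupRing M F)) :=
  Algebra.adjoin R (Set.range (P.delta F) ∪ Set.range (LinearMap.mulLeft R))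

/-- The `R`-module `ε D(M)_F` of the linear forms `ε ∘ D` with `D ∈ D(M)_F`. -/
noncomputable def augOperators : Submodule R (Module.Dual R (FormalGroupRing M F)) :=
  (P.operatorAlgebra F).toSubmodule.map
    (LinearMap.compRight R (FormalGroupRing.aug M F).toLinearMap)

/-- `H(M)_F`, the `R`-dual of `ε D(M)_F`. -/
abbrev dualOperators : Type _ := Module.Dual R (P.augOperators F)

/-- The characteristic map `c : R⟦M⟧_F → H(M)_F`, sending `u` to the evaluation at `u`. -/
noncomputable def charMap : FormalGroupRing M F →ₗ[R] P.dualOperators F :=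
  (P.augOperators F).subtype.dualMap ∘ₗ Module.Dual.eval R (FormalGroupRing M F)

end RootPairing

/-! ## Lengths in the Weyl group -/

namespace RootPairing

section WeylAction

variable {ι M N : Type*} [AddCommGroup M] [AddCommGroup N] {P : RootDatum ι M N}

/-! One inclusion is formal. Every operator in `D(M)_F` is linear over the `W`-invariants, so `ε ∘
D` kills each invariant of `I_F`; since `D(M)_F` also contains all multiplications, it kills the
ideal they generate.

For the other inclusion, let `N` be the length of `w₀`, take `a` in `S^N(M)` with `Δ_{w₀}(a) = t`,
and lift `a` to `R⟦M⟧_F`. Choose a reduced word `J_w` for every `w`, let `c_w` be the image of the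
lift under the word of `w⁻¹w₀`, and let `G` be the matrix with entries `Δ_{J_v}(c_w)`. For the
valuation filtration, `Δ_α` lowers degree by one and induces the classical `Δ_α` on the lifted
leading forms (`deltaWord_sub_symLift_mem`). Hence `ε(G)` is computed in the symmetric algebra,
where a word of divided differences depends only on its length and its product
(`symDeltaWord_congr`) and vanishes if it is not reduced (`symDeltaWord_eq_zero`). So `ε(G)` is
block triangular with respect to length, with diagonal blocks `t` times the identity. As `R⟦M⟧_F` is
complete, `det G` is a unit. On `R⟦M⟧_F` itself words may depend on the decomposition; only fixed
choices are used there.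

Given `u`, solve `G a = (Δ_{J_v} u)_v`. After multiplication by nonzerodivisors the `Δ_{J_v}` are
combinations of the elements of `W`, so the rows of `G` are combinations of the rows of `V =
(v(c_w))`, and `det V` is a nonzerodivisor. Therefore `V a = (w(u))_w`. Applying elements of `W`
permutes these equations, which forces the `a_w` to be invariant, and the equation for `w = 1` reads
`u = ∑ c_w a_w`. If `u` is in the kernel of the characteristic map, all `Δ_{J_v} u` lie in `I_F`,
hence so do all `a_w`.

The analytic input is that `R⟦M⟧_F` is complete and separated with unique polynomial leading forms,
and that `x_α` cancels at the cost of exactly one degree (`mem_filtration_of_x_mul_mem`). The latter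
uses `α^∨(α) = 2` and the absence of 2-torsion. -/

theorem weylGroup_root_smul (w : P.weylGroup) (i : ι) : P.root (w • i) = w • P.root i :=
  Equiv.root_indexEquiv_eq_smul P i (w : P.Aut)

theorem weylGroup_pairing_smul (w : P.weylGroup) (m : M) (i : ι) :
    P.toLinearMap (w • m) (P.coroot (w • i)) = P.toLinearMap m (P.coroot i) := by
  have h := LinearMap.congr_fun
    (Hom.weight_coweight_transpose_apply P P (P.coroot (w • i)) (w : P.Aut).toHom) m
  rw [Hom.coroot_coweightMap_apply] at h
  have h' : (w : P.Aut).toHom.indexEquiv.symm (w • i) = i :=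
    (w : P.Aut).toHom.indexEquiv.symm_apply_apply i
  rw [h'] at h
  exact h

theorem weylGroup_ext {v w : P.weylGroup} (h : ∀ m : M, v • m = w • m) : v = w :=
  Subtype.ext (Equiv.weightHom_injective P (LinearEquiv.ext h))

theorem ofIdx_smul_eq_sub (i : ι) (m : M) :
    weylGroup.ofIdx P i • m = m - P.toLinearMap m (P.coroot i) • P.root i :=
  P.reflection_apply i m

theorem ofIdx_smul_idx (i j : ι) : weylGroup.ofIdx P i • j = P.reflectionPerm i j :=
  rfl

theorem ofIdx_mul_self (i : ι) : weylGroup.ofIdx P i * weylGroup.ofIdx P i = 1 := by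
  refine weylGroup_ext fun m => ?_
  rw [mul_smul, one_smul]
  exact P.reflection_same i m

theorem ofIdx_inv (i : ι) : (weylGroup.ofIdx P i)⁻¹ = weylGroup.ofIdx P i :=
  inv_eq_of_mul_eq_one_left (ofIdx_mul_self i)

theorem ofIdx_smul_eq_conj (w : P.weylGroup) (i : ι) :
    weylGroup.ofIdx P (w • i) = w * weylGroup.ofIdx P i * w⁻¹ := by
  rw [eq_mul_inv_iff_mul_eq]
  refine weylGroup_ext fun m => ?_
  rw [mul_smul, mul_smul, ofIdx_smul_eq_sub, ofIdx_smul_eq_sub, weylGroup_pairing_smul,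
    weylGroup_root_smul, smul_sub]
  congr 1
  exact (map_zsmul (DistribSMul.toAddMonoidHom M w) _ _).symm

end WeylAction

/-! ### Length, exchange and the longest element. -/

section Length

variable {ι M N : Type*} [AddCommGroup M] [AddCommGroup N] {P : RootDatum ι M N} (b : P.Base)

theorem isPos_neg_iff (i : ι) : b.IsPos (P.reflectionPerm i i) ↔ ¬ b.IsPos i :=
  Base.IsPos.neg_iff_not b i

theorem smul_reflectionPerm_self (w : P.weylGroup) (i : ι) :
    w • P.reflectionPerm i i = P.reflectionPerm (w • i) (w • i) := by
  rw [← ofIdx_smul_idx, ← ofIdx_smul_idx, ofIdx_smul_eq_conj, mul_smul, mul_smul, inv_smul_smul]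

@[simp] theorem wordProd_nil : wordProd b [] = 1 := rfl

@[simp] theorem wordProd_cons (i : b.support) (I : List b.support) :
    wordProd b (i :: I) = weylGroup.ofIdx P (i : ι) * wordProd b I := by
  simp [wordProd]

@[simp] theorem wordProd_append (I J : List b.support) :
    wordProd b (I ++ J) = wordProd b I * wordProd b J := by
  simp [wordProd]

theorem wordProd_reverse (I : List b.support) : wordProd b I.reverse = (wordProd b I)⁻¹ := by
  induction I with
  | nil => simp
  | cons i I ih => simp [ih, ofIdx_inv]

theorem weylLength_wordProd_le (I : List b.support) : weylLength b (wordProd b I) ≤ I.length :=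
  Nat.sInf_le ⟨I, rfl, rfl⟩

theorem weylLength_one : weylLength b (1 : P.weylGroup) = 0 :=
  Nat.le_zero.mp (weylLength_wordProd_le b [])

variable [Finite ι]

/-- A positive root is reached from the simple ones by adding simple roots one at a time, heights
are additive, and positivity is read off from the height. -/
theorem not_isPos_smul {w : P.weylGroup} (h : ∀ i : b.support, ¬ b.IsPos (w • (i : ι))) {j : ι}
    (hj : b.IsPos j) : ¬ b.IsPos (w • j) := by
  refine hj.induction_on_add (p := fun j => ¬ b.IsPos (w • j)) (fun i hi => h ⟨i, hi⟩) ?_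
  intro i j k hk hi hj
  have hk' : P.root (w • k) = P.root (w • i) + P.root (w • j) := by
    simp only [weylGroup_root_smul, hk, smul_add]
  have hj' := h ⟨j, hj⟩
  simp only [Base.isPos_iff] at *
  rw [b.height_add hk']
  omega

variable [P.IsReduced]

theorem exists_wordProd_eq_ofIdx (i : ι) :
    ∃ I : List b.support, wordProd b I = weylGroup.ofIdx P i := by
  refine b.induction_reflect i (p := fun i => ∃ I, wordProd b I = weylGroup.ofIdx P i) ?_ ?_ ?_
  · rintro i ⟨I, hI⟩
    refine ⟨I, ?_⟩
    rw [← ofIdx_smul_idx, ofIdx_smul_eq_conj, ofIdx_mul_self, one_mul, ofIdx_inv, hI]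
  · intro i hi
    exact ⟨[⟨i, hi⟩], by simp⟩
  · rintro i j ⟨I, hI⟩ hj
    refine ⟨⟨j, hj⟩ :: (I ++ [⟨j, hj⟩]), ?_⟩
    rw [← ofIdx_smul_idx, ofIdx_smul_eq_conj, ofIdx_inv]
    simp [hI, mul_assoc]

theorem wordProd_surjective : Function.Surjective (wordProd b) := by
  rintro ⟨w, hw⟩
  induction hw using weylGroup.induction with
  | mem i => exact exists_wordProd_eq_ofIdx b i
  | one => exact ⟨[], rfl⟩
  | mul x y hx hy ihx ihy =>
    obtain ⟨I, hI⟩ := ihx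
    obtain ⟨J, hJ⟩ := ihy
    exact ⟨I ++ J, by rw [wordProd_append, hI, hJ]; rfl⟩

theorem exists_reduced_word (w : P.weylGroup) :
    ∃ I : List b.support, I.length = weylLength b w ∧ wordProd b I = w := by
  obtain ⟨I, hI⟩ := wordProd_surjective b w
  exact Nat.sInf_mem (s := {n | ∃ I : List b.support, I.length = n ∧ wordProd b I = w})
    ⟨I.length, I, rfl, hI⟩

theorem isPos_ofIdx_smul {i : ι} (hi : i ∈ b.support) {j : ι} (hj : b.IsPos j) (hij : j ≠ i) :
    b.IsPos (weylGroup.ofIdx P i • j) :=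
  hj.reflectionPerm hi hij

/-- The exchange condition. -/
theorem exists_wordProd_eq_mul_ofIdx (I : List b.support) {c : ι} (hc : b.IsPos c)
    (hI : ¬ b.IsPos (wordProd b I • c)) :
    ∃ J : List b.support, J.length + 1 = I.length ∧
      wordProd b J = wordProd b I * weylGroup.ofIdx P c := by
  induction I with
  | nil => simp [hc] at hI
  | cons i I ih =>
    -- The letter to delete is the one at which `c` turns negative. The only positive root that
    -- `s_i` makes negative is `α_i`, so at that letter the image of `c` is `α_i`.
    by_cases h : b.IsPos (wordProd b I • c)
    · refine ⟨I, rfl, ?_⟩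
      have hci : wordProd b I • c = i := by
        by_contra hne
        refine hI ?_
        rw [wordProd_cons, mul_smul]
        exact isPos_ofIdx_smul b i.2 h hne
      rw [wordProd_cons, ← hci, ofIdx_smul_eq_conj]
      simp [mul_assoc, ofIdx_mul_self]
    · obtain ⟨J, hJ, hJ'⟩ := ih h
      exact ⟨i :: J, by simp [hJ], by simp [hJ', mul_assoc]⟩

theorem weylLength_mul_ofIdx_le (w : P.weylGroup) (i : b.support) :
    weylLength b (w * weylGroup.ofIdx P (i : ι)) ≤ weylLength b w + 1 := by
  obtain ⟨I, hI, rfl⟩ := exists_reduced_word b w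
  refine (le_of_eq ?_).trans ((weylLength_wordProd_le b (I ++ [i])).trans (by simp [hI]))
  simp

theorem weylLength_mul_ofIdx_of_neg {w : P.weylGroup} {i : b.support}
    (h : ¬ b.IsPos (w • (i : ι))) :
    weylLength b (w * weylGroup.ofIdx P (i : ι)) + 1 = weylLength b w := by
  refine le_antisymm ?_ ?_
  · obtain ⟨I, hI, rfl⟩ := exists_reduced_word b w
    obtain ⟨J, hJ, hJ'⟩ := exists_wordProd_eq_mul_ofIdx b I (Base.isPos_of_mem_support i.2) h
    rw [← hI, ← hJ, ← hJ']
    exact Nat.add_le_add_right (weylLength_wordProd_le b J) 1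
  · have := weylLength_mul_ofIdx_le b (w * weylGroup.ofIdx P (i : ι)) i
    rwa [mul_assoc, ofIdx_mul_self, mul_one] at this

theorem weylLength_mul_ofIdx_of_pos {w : P.weylGroup} {i : b.support}
    (h : b.IsPos (w • (i : ι))) :
    weylLength b (w * weylGroup.ofIdx P (i : ι)) = weylLength b w + 1 := by
  have := weylLength_mul_ofIdx_of_neg b (w := w * weylGroup.ofIdx P (i : ι)) (i := i) (by
    rwa [mul_smul, ofIdx_smul_idx, smul_reflectionPerm_self, isPos_neg_iff, not_not])
  rw [mul_assoc, ofIdx_mul_self, mul_one] at this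
  exact this.symm

theorem weylLength_eq_zero {w : P.weylGroup} (h : weylLength b w = 0) : w = 1 := by
  obtain ⟨I, hI, rfl⟩ := exists_reduced_word b w
  rw [h, List.length_eq_zero_iff] at hI
  rw [hI, wordProd_nil]

theorem weylLength_inv (w : P.weylGroup) : weylLength b w⁻¹ = weylLength b w := by
  have key : ∀ w : P.weylGroup, weylLength b w⁻¹ ≤ weylLength b w := by
    intro w
    obtain ⟨I, hI, rfl⟩ := exists_reduced_word b w
    rw [← hI, ← wordProd_reverse, ← I.length_reverse]
    exact weylLength_wordProd_le b _
  exact le_antisymm (key w) (by simpa using key w⁻¹)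

/-- Each further letter changes the length of the product by exactly one, up or down. -/
theorem exists_length_eq_weylLength_add (I : List b.support) :
    ∃ m, I.length = weylLength b (wordProd b I) + 2 * m := by
  induction I using List.reverseRecOn with
  | nil => exact ⟨0, by simp [weylLength_one]⟩
  | append_singleton I i ih =>
    obtain ⟨m, hm⟩ := ih
    have hw : wordProd b (I ++ [i]) = wordProd b I * weylGroup.ofIdx P (i : ι) := by simp
    rw [List.length_append, List.length_singleton, hw]
    by_cases h : b.IsPos (wordProd b I • (i : ι))
    · exact ⟨m, by rw [weylLength_mul_ofIdx_of_pos b h]; omega⟩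
    · exact ⟨m + 1, by have := weylLength_mul_ofIdx_of_neg b h; omega⟩

/-- By maximality `w₀` makes every positive root negative. Hence a simple reflection that lengthens
`u` shortens `w₀ u`, and conversely. -/
theorem weylLength_mul_add_weylLength {w₀ : P.weylGroup}
    (h₀ : ∀ w : P.weylGroup, weylLength b w ≤ weylLength b w₀) (u : P.weylGroup) :
    weylLength b (w₀ * u) + weylLength b u = weylLength b w₀ := by
  have hneg : ∀ i : b.support, ¬ b.IsPos (w₀ • (i : ι)) := by
    intro i hi
    have := h₀ (w₀ * weylGroup.ofIdx P (i : ι))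
    rw [weylLength_mul_ofIdx_of_pos b hi] at this
    omega
  obtain ⟨I, rfl⟩ := wordProd_surjective b u
  induction I using List.reverseRecOn with
  | nil => simp [weylLength_one]
  | append_singleton I i ih =>
    have hw : wordProd b (I ++ [i]) = wordProd b I * weylGroup.ofIdx P (i : ι) := by simp
    rw [hw, ← mul_assoc]
    by_cases h : b.IsPos (wordProd b I • (i : ι))
    · have h' : ¬ b.IsPos ((w₀ * wordProd b I) • (i : ι)) := by
        rw [mul_smul]
        exact not_isPos_smul b hneg h
      have h1 := weylLength_mul_ofIdx_of_pos b h
      have h2 := weylLength_mul_ofIdx_of_neg b h'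
      omega
    · have h' : b.IsPos ((w₀ * wordProd b I) • (i : ι)) := by
        rw [← not_not (a := b.IsPos _), ← isPos_neg_iff, ← smul_reflectionPerm_self, mul_smul]
        refine not_isPos_smul b hneg ?_
        rwa [smul_reflectionPerm_self, isPos_neg_iff]
      have h1 := weylLength_mul_ofIdx_of_neg b h
      have h2 := weylLength_mul_ofIdx_of_pos b h'
      omega

/-- The inverse `w⁻¹` is also of maximal length, so the complement formula gives `w⁻¹ w₀` length
zero. -/
theorem eq_of_weylLength_eq {w₀ w : P.weylGroup}
    (h₀ : ∀ w : P.weylGroup, weylLength b w ≤ weylLength b w₀)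
    (h : weylLength b w = weylLength b w₀) : w = w₀ := by
  have h1 := weylLength_mul_add_weylLength b (w₀ := w⁻¹)
    (by simpa only [weylLength_inv, h] using h₀) w₀
  rw [weylLength_inv, h] at h1
  have h2 := weylLength_eq_zero b (w := w⁻¹ * w₀) (by omega)
  exact (inv_mul_eq_one.mp h2)

theorem weylLength_inv_mul {w₀ : P.weylGroup}
    (h₀ : ∀ w : P.weylGroup, weylLength b w ≤ weylLength b w₀) (v : P.weylGroup) :
    weylLength b (v⁻¹ * w₀) + weylLength b v = weylLength b w₀ := by
  have h1 := weylLength_mul_add_weylLength b (w₀ := w₀⁻¹)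
    (by simpa only [weylLength_inv] using h₀) v
  rwa [← weylLength_inv b (w₀⁻¹ * v), mul_inv_rev, inv_inv, weylLength_inv b w₀] at h1

theorem finite_weylGroup {n : ℕ} (h : ∀ w : P.weylGroup, weylLength b w ≤ n) :
    Finite P.weylGroup := by
  have hfin : {I : List b.support | I.length ≤ n}.Finite := List.finite_length_le _ n
  have := hfin.to_subtype
  refine Finite.of_surjective
    (fun I : {I : List b.support | I.length ≤ n} => wordProd b I.1) fun w => ?_
  obtain ⟨I, hI, hw⟩ := exists_reduced_word b w
  exact ⟨⟨I, hI.trans_le (h w)⟩, hw⟩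

end Length

end RootPairing

/-! ## Divided differences on the symmetric algebra -/

namespace SymmetricAlgebra

variable {M : Type*} [AddCommGroup M] [Module.Free ℤ M]

instance isDomain_int : IsDomain (SymmetricAlgebra ℤ M) :=
  (equivMvPolynomial (Module.Free.chooseBasis ℤ M)).toMulEquiv.isDomain _

instance charZero_int : CharZero (SymmetricAlgebra ℤ M) :=
  charZero_of_injective_algebraMap (R := ℤ) fun x y h => (algebraMap_inj M x y).mp h

theorem ι_int_injective : Function.Injective (ι ℤ M) := by
  intro x y h
  have h' := congrArg (equivMvPolynomial (Module.Free.chooseBasis ℤ M)) h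
  have key : ∀ z, equivMvPolynomial (Module.Free.chooseBasis ℤ M) (ι ℤ M z) =
      ((Module.Free.chooseBasis ℤ M).constr ℤ (MvPolynomial.X (R := ℤ))) z := by
    intro z
    exact lift_ι_apply _ _
  rw [key, key] at h'
  refine (Module.Free.chooseBasis ℤ M).repr.injective (Finsupp.ext fun i => ?_)
  have hc : ∀ z, MvPolynomial.coeff (Finsupp.single i 1)
      ((Module.Free.chooseBasis ℤ M).constr ℤ (MvPolynomial.X (R := ℤ)) z) =
        (Module.Free.chooseBasis ℤ M).repr z i := by
    classical
    intro z
    rw [Module.Basis.constr_apply, Finsupp.sum, MvPolynomial.coeff_sum]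
    simp only [MvPolynomial.coeff_smul, MvPolynomial.coeff_X, smul_eq_mul, mul_ite, mul_one,
      mul_zero, Finsupp.single_left_inj (one_ne_zero : (1 : ℕ) ≠ 0)]
    rw [Finset.sum_ite_eq' _ i]
    split_ifs with h
    · rfl
    · exact (Finsupp.notMem_support_iff.mp h).symm
  rw [← hc, ← hc, h']

omit [Module.Free ℤ M] in
-- The kernel of `T` is an ideal containing `1`. This serves to compare two operators through their
-- commutation with elements of `M`.
theorem eq_zero_of_ι_mul {T : Module.End ℤ (SymmetricAlgebra ℤ M)} (h₁ : T 1 = 0)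
    (h : ∀ m u, T u = 0 → T (ι ℤ M m * u) = 0) : T = 0 := by
  have key : ∀ a u, T u = 0 → T (a * u) = 0 := by
    intro a
    induction a using SymmetricAlgebra.induction with
    | algebraMap r =>
      intro u hu
      rw [← Algebra.smul_def, map_smul, hu, smul_zero]
    | ι m => exact h m
    | mul a c ha hc =>
      intro u hu
      rw [mul_assoc]
      exact ha _ (hc _ hu)
    | add a c ha hc =>
      intro u hu
      rw [add_mul, map_add, ha _ hu, hc _ hu, add_zero]
  exact LinearMap.ext fun a => by simpa using key a 1 h₁

end SymmetricAlgebra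

namespace RootPairing

section SymDelta

variable {ι M N : Type*} [AddCommGroup M] [AddCommGroup N] (P : RootDatum ι M N)

@[simp] theorem symReflection_ι (i : ι) (m : M) :
    P.symReflection i (SymmetricAlgebra.ι ℤ M m) =
      SymmetricAlgebra.ι ℤ M (weylGroup.ofIdx P i • m) :=
  SymmetricAlgebra.lift_ι_apply _ _

theorem ι_ofIdx_smul (i : ι) (m : M) : SymmetricAlgebra.ι ℤ M (weylGroup.ofIdx P i • m) =
    SymmetricAlgebra.ι ℤ M m -
      P.toLinearMap m (P.coroot i) • SymmetricAlgebra.ι ℤ M (P.root i) := by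
  rw [ofIdx_smul_eq_sub, map_sub, map_smul]

theorem ofIdx_smul_root (i : ι) : weylGroup.ofIdx P i • P.root i = -P.root i :=
  P.reflection_apply_self i

theorem symReflection_symReflection (i : ι) (u : SymmetricAlgebra ℤ M) :
    P.symReflection i (P.symReflection i u) = u := by
  have h : (P.symReflection i).comp (P.symReflection i) = AlgHom.id ℤ _ := by
    refine SymmetricAlgebra.algHom_ext (LinearMap.ext fun m => ?_)
    change P.symReflection i (P.symReflection i (SymmetricAlgebra.ι ℤ M m)) =
      SymmetricAlgebra.ι ℤ M m
    rw [symReflection_ι, symReflection_ι, ← mul_smul, ofIdx_mul_self, one_smul]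
  exact DFunLike.congr_fun h u

theorem dvd_sub_symReflection (i : ι) (u : SymmetricAlgebra ℤ M) :
    SymmetricAlgebra.ι ℤ M (P.root i) ∣ u - P.symReflection i u := by
  induction u using SymmetricAlgebra.induction with
  | algebraMap r => simp
  | ι m =>
    rw [symReflection_ι, ι_ofIdx_smul, sub_sub_cancel]
    exact Dvd.intro_left _ (zsmul_eq_mul _ _).symm
  | mul u v hu hv =>
    have : u * v - P.symReflection i (u * v) = (u - P.symReflection i u) * v +
        P.symReflection i u * (v - P.symReflection i v) := by rw [map_mul]; ring
    rw [this]
    exact dvd_add (hu.mul_right _) (hv.mul_left _)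
  | add u v hu hv =>
    rw [map_add, add_sub_add_comm]
    exact dvd_add hu hv

variable [Module.Free ℤ M]

theorem ι_root_ne_zero [Finite ι] (i : ι) : SymmetricAlgebra.ι ℤ M (P.root i) ≠ 0 := by
  intro h
  exact P.ne_zero i (SymmetricAlgebra.ι_int_injective (h.trans (map_zero _).symm))

variable [Finite ι]

theorem mul_symDelta (i : ι) (u : SymmetricAlgebra ℤ M) :
    SymmetricAlgebra.ι ℤ M (P.root i) * P.symDelta i u = u - P.symReflection i u :=
  mul_dividedDifference _ (IsLeftCancelMulZero.mul_left_cancel_of_ne_zero (P.ι_root_ne_zero i))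
    (P.dvd_sub_symReflection i) u

theorem symDelta_eq_of_mul_eq {i : ι} {u v : SymmetricAlgebra ℤ M}
    (h : SymmetricAlgebra.ι ℤ M (P.root i) * v = u - P.symReflection i u) :
    P.symDelta i u = v :=
  mul_left_cancel₀ (P.ι_root_ne_zero i) ((P.mul_symDelta i u).trans h.symm)

theorem symDelta_one (i : ι) : P.symDelta i 1 = 0 :=
  P.symDelta_eq_of_mul_eq (by simp)

theorem symDelta_ι_mul (i : ι) (m : M) (u : SymmetricAlgebra ℤ M) :
    P.symDelta i (SymmetricAlgebra.ι ℤ M m * u) =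
      SymmetricAlgebra.ι ℤ M (weylGroup.ofIdx P i • m) * P.symDelta i u +
        P.toLinearMap m (P.coroot i) • u := by
  refine P.symDelta_eq_of_mul_eq ?_
  rw [mul_add, mul_left_comm, mul_symDelta, map_mul, symReflection_ι, ι_ofIdx_smul,
    zsmul_eq_mul, zsmul_eq_mul]
  ring

/-- Applying `s_α` to `α Δ_α(u) = u - s_α(u)` changes the sign of both `α` and the right side, so
`Δ_α(u)` is `s_α`-invariant. -/
theorem symDelta_symDelta (i : ι) (u : SymmetricAlgebra ℤ M) :
    P.symDelta i (P.symDelta i u) = 0 := by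
  refine P.symDelta_eq_of_mul_eq ?_
  have h := congrArg (P.symReflection i) (P.mul_symDelta i u)
  rw [map_mul, map_sub, symReflection_symReflection, symReflection_ι, ofIdx_smul_root, map_neg,
    ← neg_sub u, ← mul_symDelta, neg_mul, neg_inj] at h
  rw [mul_left_cancel₀ (P.ι_root_ne_zero i) h, mul_zero, sub_self]

theorem symDelta_mem_pow (i : ι) (k : ℕ) {u : SymmetricAlgebra ℤ M}
    (hu : u ∈ LinearMap.range (SymmetricAlgebra.ι ℤ M) ^ (k + 1)) :
    P.symDelta i u ∈ LinearMap.range (SymmetricAlgebra.ι ℤ M) ^ k := by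
  induction k generalizing u with
  | zero =>
    rw [zero_add, pow_one] at hu
    obtain ⟨m, rfl⟩ := hu
    rw [← mul_one (SymmetricAlgebra.ι ℤ M m), symDelta_ι_mul, symDelta_one, mul_zero, zero_add,
      pow_zero]
    exact Submodule.smul_mem _ _ (Submodule.one_le.mp le_rfl)
  | succ k ih =>
    rw [pow_succ'] at hu
    refine Submodule.mul_induction_on hu ?_ ?_
    · rintro _ ⟨m, rfl⟩ v hv
      rw [symDelta_ι_mul]
      refine add_mem ?_ (Submodule.smul_mem _ _ hv)
      rw [pow_succ']
      exact Submodule.mul_mem_mul ⟨_, rfl⟩ (ih hv)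
    · intro u v hu hv
      rw [map_add]
      exact add_mem hu hv

end SymDelta

/-! ### Words of classical divided differences. -/

section Word

variable {ι M N : Type*} [AddCommGroup M] [AddCommGroup N] {P : RootDatum ι M N} (b : P.Base)

/-- The composition `Δ_{i_1} ∘ ⋯ ∘ Δ_{i_l}` on the symmetric algebra. -/
noncomputable def symDeltaWord (I : List b.support) : Module.End ℤ (SymmetricAlgebra ℤ M) :=
  (I.map fun i => P.symDelta (i : ι)).prod

@[simp] theorem symDeltaWord_nil : symDeltaWord b [] = 1 := rfl

@[simp] theorem symDeltaWord_cons (i : b.support) (I : List b.support) :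
    symDeltaWord b (i :: I) = P.symDelta (i : ι) * symDeltaWord b I := by
  simp [symDeltaWord]

@[simp] theorem symDeltaWord_append (I J : List b.support) :
    symDeltaWord b (I ++ J) = symDeltaWord b I * symDeltaWord b J := by
  simp [symDeltaWord]

/-- The words obtained from `I` by deleting one letter `i_j`, each with the index of the root
`s_{i_l} ⋯ s_{i_{j+1}}(α_{i_j})`. -/
noncomputable def deletions : List b.support → List (ι × List b.support)
  | [] => []
  | i :: I => ((wordProd b I)⁻¹ • (i : ι), I) :: (deletions I).map fun p => (p.1, i :: p.2)

theorem length_add_one_of_mem_deletions {I : List b.support} {p : ι × List b.support}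
    (hp : p ∈ deletions b I) : p.2.length + 1 = I.length := by
  induction I generalizing p with
  | nil => simp [deletions] at hp
  | cons i I ih =>
    rw [deletions, List.mem_cons, List.mem_map] at hp
    rcases hp with rfl | ⟨q, hq, rfl⟩
    · rfl
    · simp [← ih hq]

theorem wordProd_of_mem_deletions {I : List b.support} {p : ι × List b.support}
    (hp : p ∈ deletions b I) :
    wordProd b p.2 = wordProd b I * weylGroup.ofIdx P p.1 := by
  induction I generalizing p with
  | nil => simp [deletions] at hp
  | cons i I ih =>
    rw [deletions, List.mem_cons, List.mem_map] at hp
    rcases hp with rfl | ⟨q, hq, rfl⟩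
    · rw [wordProd_cons, ofIdx_smul_eq_conj, inv_inv]
      simp only [mul_assoc, mul_inv_cancel_left]
      rw [← mul_assoc, ofIdx_mul_self, one_mul]
    · rw [wordProd_cons, wordProd_cons, ih hq, mul_assoc]

theorem reflectionPerm_self_eq_ofIdx (i : ι) :
    weylGroup.ofIdx P (P.reflectionPerm i i) = weylGroup.ofIdx P i := by
  rw [← ofIdx_smul_idx, ofIdx_smul_eq_conj, ofIdx_mul_self, one_mul, ofIdx_inv]

/-- Iterated twisted Leibniz rule: either every letter passes the factor `m` and acts on it by its
reflection, or one letter consumes it, becomes a scalar and disappears from the word. -/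
theorem symDeltaWord_ι_mul [Module.Free ℤ M] [Finite ι] (I : List b.support) (m : M)
    (u : SymmetricAlgebra ℤ M) :
    symDeltaWord b I (SymmetricAlgebra.ι ℤ M m * u) =
      SymmetricAlgebra.ι ℤ M (wordProd b I • m) * symDeltaWord b I u +
        ((deletions b I).map fun p =>
          P.toLinearMap m (P.coroot p.1) • symDeltaWord b p.2 u).sum := by
  induction I with
  | nil => simp [deletions]
  | cons i I ih =>
    have hp : P.toLinearMap (wordProd b I • m) (P.coroot i) =
        P.toLinearMap m (P.coroot ((wordProd b I)⁻¹ • (i : ι))) := by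
      rw [← weylGroup_pairing_smul (wordProd b I) m, smul_inv_smul]
    rw [symDeltaWord_cons, Module.End.mul_apply, ih, map_add, symDelta_ι_mul, ← mul_smul, hp,
      deletions, List.map_cons, List.sum_cons, List.map_map, map_list_sum, List.map_map,
      wordProd_cons, Module.End.mul_apply, add_assoc, mul_smul]
    simp only [Function.comp_def, map_smul, symDeltaWord_cons, Module.End.mul_apply]

theorem symDeltaWord_one [Module.Free ℤ M] [Finite ι] {I : List b.support} (hI : I ≠ []) :
    symDeltaWord b I 1 = 0 := by
  induction I with
  | nil => exact absurd rfl hI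
  | cons i I ih =>
    rw [symDeltaWord_cons, Module.End.mul_apply]
    by_cases h : I = []
    · rw [h, symDeltaWord_nil, Module.End.one_apply, symDelta_one]
    · rw [ih h, map_zero]

section OddSums

variable [Fintype ι] [P.IsReduced] {G : Type*} [AddCommGroup G]

open Classical in
-- The reflection `s_i` permutes the positive roots other than `α_i`, so everything cancels except
-- the term of `α_i`, which oddness of `h` doubles.
theorem sum_pos_sub_ofIdx_smul {h : ι → G} (hh : ∀ i, h (P.reflectionPerm i i) = -h i)
    (i : b.support) :
    ∑ c with b.IsPos c, (h c - h (weylGroup.ofIdx P (i : ι) • c)) = 2 • h i := by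
  have hi : (i : ι) ∈ Finset.univ.filter fun c => b.IsPos c := by
    simp [Base.isPos_of_mem_support i.2]
  have hne : ∀ {c : ι}, b.IsPos c → c ≠ i → weylGroup.ofIdx P (i : ι) • c ≠ i := by
    intro c hc hci he
    have h1 : c = P.reflectionPerm i i := by
      rw [← ofIdx_smul_idx, ← ofIdx_inv, eq_inv_smul_iff, he]
    rw [h1, isPos_neg_iff] at hc
    exact hc (Base.isPos_of_mem_support i.2)
  rw [← Finset.add_sum_erase _ _ hi, ofIdx_smul_idx, hh, sub_neg_eq_add, ← two_smul ℕ,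
    Finset.sum_sub_distrib, add_eq_left, sub_eq_zero]
  symm
  refine Finset.sum_nbij' (fun c => weylGroup.ofIdx P (i : ι) • c)
    (fun c => weylGroup.ofIdx P (i : ι) • c) ?_ ?_ ?_ ?_ ?_
  · intro c hc
    simp only [Finset.mem_erase, Finset.mem_filter, Finset.mem_univ, true_and] at hc ⊢
    exact ⟨hne hc.2 hc.1, isPos_ofIdx_smul b i.2 hc.2 hc.1⟩
  · intro c hc
    simp only [Finset.mem_erase, Finset.mem_filter, Finset.mem_univ, true_and] at hc ⊢
    exact ⟨hne hc.2 hc.1, isPos_ofIdx_smul b i.2 hc.2 hc.1⟩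
  · intro c _
    rw [← mul_smul, ofIdx_mul_self, one_smul]
  · intro c _
    rw [← mul_smul, ofIdx_mul_self, one_smul]
  · intro c _
    rfl

open Classical in
-- The right side involves only the product of the word. Thus a sum over deletions, once doubled, is
-- independent of the word, reduced or not; oddness of `g` accounts for the roots that occur
-- repeatedly.
theorem two_smul_sum_deletions {g : ι → G} (hg : ∀ i, g (P.reflectionPerm i i) = -g i)
    (I : List b.support) :
    2 • ((deletions b I).map fun p => g p.1).sum =
      ∑ c with b.IsPos c, (g c - g ((wordProd b I)⁻¹ • c)) := by
  induction I with
  | nil => simp [deletions]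
  | cons i I ih =>
    have h := sum_pos_sub_ofIdx_smul b (h := fun c => g ((wordProd b I)⁻¹ • c)) (fun c => by
      rw [smul_reflectionPerm_self, hg]) i
    rw [deletions, List.map_cons, List.sum_cons, List.map_map, smul_add, ← h, add_comm]
    refine (congrArg (· + _) ih).trans ?_
    rw [← Finset.sum_add_distrib]
    refine Finset.sum_congr rfl fun c _ => ?_
    rw [wordProd_cons, mul_inv_rev, ofIdx_inv, mul_smul, sub_add_sub_cancel]

end OddSums

variable [Module.Free ℤ M] [Finite ι] [P.IsReduced]

/-- Induction on the length, without braid relations. The twisted commutator with `m ∈ M` is a sum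
over deletions, which are words one letter shorter and so, by induction, depend only on their
products. By `two_smul_sum_deletions` twice this commutator depends only on the product of the word,
and the symmetric algebra has no 2-torsion. Since nonempty words kill `1`, `eq_zero_of_ι_mul`
applies to the difference. -/
theorem symDeltaWord_congr {I J : List b.support} (hl : I.length = J.length)
    (hw : wordProd b I = wordProd b J) : symDeltaWord b I = symDeltaWord b J := by
  classical
  have := Fintype.ofFinite ι
  obtain ⟨n, hn⟩ : ∃ n, J.length = n := ⟨_, rfl⟩
  rw [hn] at hl
  induction n generalizing I J with
  | zero => rw [List.length_eq_zero_iff.mp hl, List.length_eq_zero_iff.mp hn]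
  | succ n ih =>
    -- By induction a word of length `n` acts through its product. The default `0` is harmless: the
    -- sum over deletions evaluates `D` only at products of words of length `n`.
    let D : P.weylGroup → Module.End ℤ (SymmetricAlgebra ℤ M) := fun w =>
      if h : ∃ K : List b.support, K.length = n ∧ wordProd b K = w then
        symDeltaWord b h.choose else 0
    have hD : ∀ K : List b.support, K.length = n → symDeltaWord b K = D (wordProd b K) := by
      intro K hK
      have h : ∃ L : List b.support, L.length = n ∧ wordProd b L = wordProd b K := ⟨K, hK, rfl⟩
      rw [show D (wordProd b K) = symDeltaWord b h.choose from dif_pos h]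
      exact ih h.choose_spec.2.symm hK h.choose_spec.1
    have key : ∀ K : List b.support, K.length = n + 1 → ∀ (m : M) (u : SymmetricAlgebra ℤ M),
        2 • (symDeltaWord b K (SymmetricAlgebra.ι ℤ M m * u) -
          SymmetricAlgebra.ι ℤ M (wordProd b K • m) * symDeltaWord b K u) =
        ∑ c with b.IsPos c,
          (P.toLinearMap m (P.coroot c) • D (wordProd b K * weylGroup.ofIdx P c) u -
            P.toLinearMap m (P.coroot ((wordProd b K)⁻¹ • c)) •
              D (wordProd b K * weylGroup.ofIdx P ((wordProd b K)⁻¹ • c)) u) := by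
      intro K hK m u
      rw [← two_smul_sum_deletions b
        (g := fun c => P.toLinearMap m (P.coroot c) • D (wordProd b K * weylGroup.ofIdx P c) u)
        (fun c => by
          rw [reflectionPerm_self_eq_ofIdx, P.coroot_reflectionPerm, P.coreflection_apply_self,
            map_neg, neg_smul]) K,
        symDeltaWord_ι_mul, add_sub_cancel_left]
      congr 2
      refine List.map_congr_left fun p hp => ?_
      have hl := length_add_one_of_mem_deletions b hp
      rw [hD p.2 (by omega), wordProd_of_mem_deletions b hp]
    refine sub_eq_zero.mp (SymmetricAlgebra.eq_zero_of_ι_mul ?_ fun m u hu => ?_)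
    · rw [LinearMap.sub_apply, symDeltaWord_one b (List.ne_nil_of_length_eq_add_one hl),
        symDeltaWord_one b (List.ne_nil_of_length_eq_add_one hn), sub_zero]
    · have h := (key I hl m u).trans ((hw ▸ key J hn m u).symm)
      rw [nsmul_eq_mul, nsmul_eq_mul] at h
      have h' := mul_left_cancel₀ (by norm_num) h
      rw [LinearMap.sub_apply, sub_eq_zero] at hu ⊢
      rwa [hu, sub_left_inj] at h'

/-- The excess of the word over the length of its product is even and positive. The word may
therefore be replaced by a reduced one followed by pairs `i, i`, and `Δ_i² = 0`. -/
theorem symDeltaWord_eq_zero {I : List b.support}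
    (hI : weylLength b (wordProd b I) < I.length) : symDeltaWord b I = 0 := by
  obtain ⟨m, hm⟩ := exists_length_eq_weylLength_add b I
  obtain ⟨J, hJ, hJ'⟩ := exists_reduced_word b (wordProd b I)
  obtain ⟨i⟩ : Nonempty b.support := by
    cases I with
    | nil => simp at hI
    | cons i _ => exact ⟨i⟩
  obtain ⟨m, rfl⟩ : ∃ k, m = k + 1 := ⟨m - 1, by omega⟩
  have hrep : ∀ k, wordProd b (List.replicate (2 * k) i) = 1 := by
    intro k
    induction k with
    | zero => rfl
    | succ k ih =>
      rw [show 2 * (k + 1) = 2 * k + 1 + 1 by ring, List.replicate_succ, List.replicate_succ,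
        wordProd_cons, wordProd_cons, ih, mul_one, ofIdx_mul_self]
  rw [symDeltaWord_congr b (J := J ++ List.replicate (2 * (m + 1)) i)
    (by rw [hm, List.length_append, List.length_replicate, hJ])
    (by rw [wordProd_append, hrep, mul_one, hJ']), symDeltaWord_append,
    show 2 * (m + 1) = 2 * m + 1 + 1 by ring, List.replicate_succ, List.replicate_succ,
    symDeltaWord_cons, symDeltaWord_cons]
  refine LinearMap.ext fun u => ?_
  simp [symDelta_symDelta]

theorem exists_symDeltaWord_eq_torsionIndex {I : List b.support} (hI : IsReducedLongest b I) :
    ∃ a ∈ LinearMap.range (SymmetricAlgebra.ι ℤ M) ^ I.length,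
      symDeltaWord b I a = algebraMap ℤ _ (torsionIndex b : ℤ) := by
  let H : AddSubgroup ℤ :=
    { carrier := {t | ∃ a ∈ LinearMap.range (SymmetricAlgebra.ι ℤ M) ^ I.length,
        symDeltaWord b I a = algebraMap ℤ _ t}
      zero_mem' := ⟨0, zero_mem _, by simp⟩
      add_mem' := by
        rintro s t ⟨u, hu, hu'⟩ ⟨v, hv, hv'⟩
        exact ⟨u + v, add_mem hu hv, by rw [map_add, map_add, hu', hv']⟩
      neg_mem' := by
        rintro s ⟨u, hu, hu'⟩
        exact ⟨-u, neg_mem hu, by rw [map_neg, map_neg, hu']⟩ }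
  have hle : torsionSubgroup b ≤ H := by
    refine (AddSubgroup.closure_le H).mpr ?_
    rintro t ⟨J, hJ, a, ha, hat⟩
    have hw : wordProd b J = wordProd b I :=
      eq_of_weylLength_eq b hI.2 (le_antisymm (hI.2 _) (hJ.2 _))
    have hl : J.length = I.length := by rw [hI.1, hJ.1, hw]
    refine ⟨a, hl ▸ ha, ?_⟩
    rw [← symDeltaWord_congr b hl hw]
    exact hat
  -- The index annihilates the quotient of `ℤ`, hence lies in the subgroup; for infinite index it is
  -- `0`.
  have hmem : (torsionIndex b : ℤ) ∈ torsionSubgroup b := by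
    have h := (torsionSubgroup b).nsmul_index_mem (1 : ℤ)
    rwa [nsmul_eq_mul, mul_one] at h
  exact hle hmem

end Word

end RootPairing

/-! ## The valuation filtration on the completed polynomial ring -/

namespace CompletedPoly

open MvPowerSeries

section Valuation

variable {S R : Type*} [CommRing R]

theorem mem_valuationIdeal {n : ℕ} {f : CompletedPoly S R} : f ∈ valuationIdeal S R n ↔
    ∀ d : S →₀ ℕ, d.degree < n → coeff d (f : MvPowerSeries S R) = 0 :=
  Iff.rfl

theorem valuationIdeal_anti : Antitone (valuationIdeal S R) :=
  fun _ _ h _ hf d hd => hf d (hd.trans_le h)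

theorem valuationIdeal_zero : valuationIdeal S R 0 = ⊤ :=
  eq_top_iff.mpr fun _ _ _ hd => absurd hd (Nat.not_lt_zero _)

theorem mul_mem_valuationIdeal {m n : ℕ} {f g : CompletedPoly S R}
    (hf : f ∈ valuationIdeal S R m) (hg : g ∈ valuationIdeal S R n) :
    f * g ∈ valuationIdeal S R (m + n) := by
  classical
  intro d hd
  rw [MulMemClass.coe_mul, coeff_mul]
  refine Finset.sum_eq_zero fun p hp => ?_
  rw [Finset.HasAntidiagonal.mem_antidiagonal] at hp
  have : p.1.degree + p.2.degree = d.degree := by rw [← hp, map_add]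
  rcases lt_or_ge p.1.degree m with h | h
  · rw [hf p.1 h, zero_mul]
  · rw [hg p.2 (by omega), mul_zero]

theorem var_mem_valuationIdeal (s : S) : var R s ∈ valuationIdeal S R 1 := by
  classical
  intro d hd
  change coeff d (X s) = 0
  rw [coeff_X, if_neg]
  rintro rfl
  simp at hd

theorem mem_valuationIdeal_one {f : CompletedPoly S R} :
    f ∈ valuationIdeal S R 1 ↔ aug S R f = 0 := by
  refine ⟨fun h => h 0 (by simp), fun h d hd => ?_⟩
  rw [Nat.lt_one_iff, Finsupp.degree_eq_zero_iff] at hd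
  rw [hd]
  exact h

/-- Polynomials as elements of the completion. -/
noncomputable def ofPoly (S R : Type*) [CommRing R] : MvPolynomial S R →ₐ[R] CompletedPoly S R :=
  MvPolynomial.aeval (var R)

theorem coe_ofPoly (p : MvPolynomial S R) :
    (ofPoly S R p : MvPowerSeries S R) = (p : MvPowerSeries S R) := by
  have h : (CompletedPoly S R).val.comp (ofPoly S R) =
      MvPolynomial.coeToMvPowerSeries.algHom R := by
    refine MvPolynomial.algHom_ext fun s => ?_
    rw [AlgHom.comp_apply, ofPoly, MvPolynomial.aeval_X]
    simp [var]
  simpa using DFunLike.congr_fun h p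

theorem ofPoly_mem_valuationIdeal {n : ℕ} {p : MvPolynomial S R} :
    ofPoly S R p ∈ valuationIdeal S R n ↔ ∀ d : S →₀ ℕ, d.degree < n → p.coeff d = 0 := by
  simp only [mem_valuationIdeal, coe_ofPoly, MvPolynomial.coeff_coe]

theorem exists_isHomogeneous_sub_mem {n : ℕ} {f : CompletedPoly S R}
    (hf : f ∈ valuationIdeal S R n) :
    ∃ p : MvPolynomial S R, p.IsHomogeneous n ∧
      f - ofPoly S R p ∈ valuationIdeal S R (n + 1) := by
  classical
  let p : MvPolynomial S R :=
    ∑ d ∈ (f.2 n).toFinset, MvPolynomial.monomial d (coeff d (f : MvPowerSeries S R))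
  refine ⟨p, MvPolynomial.IsHomogeneous.sum _ _ _ fun d hd => ?_, fun d hd => ?_⟩
  · rw [Set.Finite.mem_toFinset] at hd
    exact MvPolynomial.isHomogeneous_monomial _ hd.1
  · have hp : p.coeff d = if d.degree = n then coeff d (f : MvPowerSeries S R) else 0 := by
      simp only [p, MvPolynomial.coeff_sum, MvPolynomial.coeff_monomial, Finset.sum_ite_eq',
        Set.Finite.mem_toFinset, Set.mem_ofPred_eq]
      by_cases h : d.degree = n <;> by_cases h' : coeff d (f : MvPowerSeries S R) = 0 <;>
        simp [h, h']
    rw [AddSubgroupClass.coe_sub, map_sub, coe_ofPoly, MvPolynomial.coeff_coe, hp]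
    split_ifs with h
    · rw [sub_self]
    · rw [hf d (by omega), sub_zero]

theorem exists_sub_ofPoly_mem (f : CompletedPoly S R) (n : ℕ) :
    ∃ p : MvPolynomial S R, f - ofPoly S R p ∈ valuationIdeal S R n := by
  induction n with
  | zero => exact ⟨0, by simp [valuationIdeal_zero]⟩
  | succ n ih =>
    obtain ⟨p, hp⟩ := ih
    obtain ⟨q, -, hq⟩ := exists_isHomogeneous_sub_mem hp
    exact ⟨p + q, by rwa [map_add, ← sub_sub]⟩

theorem exists_limit (f : ℕ → CompletedPoly S R)
    (hf : ∀ n, f (n + 1) - f n ∈ valuationIdeal S R n) :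
    ∃ g, ∀ n, g - f n ∈ valuationIdeal S R n := by
  have hf' : ∀ m n, m ≤ n → f n - f m ∈ valuationIdeal S R m := by
    intro m n h
    induction n, h using Nat.le_induction with
    | base => simp
    | succ n h ih =>
      rw [← sub_add_sub_cancel _ (f n)]
      exact add_mem (valuationIdeal_anti h (hf n)) ih
  have hc : ∀ (d : S →₀ ℕ) (n : ℕ), d.degree < n → coeff d (f n : MvPowerSeries S R) =
      coeff d (f (d.degree + 1) : MvPowerSeries S R) := by
    intro d n h
    have := hf' (d.degree + 1) n h d (Nat.lt_succ_self _)
    rwa [AddSubgroupClass.coe_sub, map_sub, sub_eq_zero] at this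
  -- Coefficients of degree `k` are final from the term `k + 1` on, which also makes them finitely
  -- many in each degree.
  let g : MvPowerSeries S R := fun d => coeff d (f (d.degree + 1) : MvPowerSeries S R)
  have hg : ∀ d, coeff d g = coeff d (f (d.degree + 1) : MvPowerSeries S R) := fun d => rfl
  refine ⟨⟨g, fun n => ((f (n + 1)).2 n).subset ?_⟩, fun n d hd => ?_⟩
  · rintro d ⟨rfl, h⟩
    exact ⟨rfl, h⟩
  · rw [AddSubgroupClass.coe_sub, map_sub, hc d n hd]
    exact sub_eq_zero.mpr (hg d)

theorem evalTwo_add (G H : MvPowerSeries (Fin 2) R) (s t : S) :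
    evalTwo (G + H) s t = evalTwo G s t + evalTwo H s t :=
  Subtype.ext (subst_add HasSubst.X_X G H)

theorem evalTwo_mul (G H : MvPowerSeries (Fin 2) R) (s t : S) :
    evalTwo (G * H) s t = evalTwo G s t * evalTwo H s t :=
  Subtype.ext (subst_mul HasSubst.X_X G H)

theorem evalTwo_X_zero (s t : S) : evalTwo (X 0 : MvPowerSeries (Fin 2) R) s t = var R s :=
  Subtype.ext (subst_X HasSubst.X_X 0)

theorem evalTwo_X_one (s t : S) : evalTwo (X 1 : MvPowerSeries (Fin 2) R) s t = var R t :=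
  Subtype.ext (subst_X HasSubst.X_X 1)

end Valuation

end CompletedPoly

/-! ### The shape of a commutative formal group law. -/

namespace FormalGroup

open MvPowerSeries

variable {R : Type*} [CommRing R] (F : FormalGroup R)

theorem coeff_eq_zero_of_apply_one {d : Fin 2 →₀ ℕ} (hd : d 1 = 0) :
    coeff d (F.toPowerSeries - X 0) = 0 := by
  classical
  have h0 : d = Finsupp.single 0 (d 0) := by
    ext i
    fin_cases i <;> simp [hd]
  have h := congrArg (PowerSeries.coeff (d 0)) F.Xzero_eq_X
  rw [PowerSeries.coeff, coeff_subst (hasSubst_of_constantCoeff_zero (by simp [Fin.forall_fin_two, PowerSeries.X])),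
    finsum_eq_single _ d] at h
  · rw [map_sub, sub_eq_zero]
    simp only [Finsupp.prod_fintype, pow_zero, implies_true, Fin.prod_univ_two,
      Matrix.cons_val_zero, Matrix.cons_val_one, hd, mul_one, smul_eq_mul] at h
    have h1 : (coeff (Finsupp.single () (d 0))) ((PowerSeries.X : PowerSeries R) ^ d 0) = 1 := by
      exact PowerSeries.coeff_X_pow_self (d 0)
    rw [h1, mul_one] at h
    rw [h, ← PowerSeries.coeff, PowerSeries.coeff_X, coeff_X, h0]
    simp [(Finsupp.single_injective (0 : Fin 2)).eq_iff]
  · intro e he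
    by_cases h1 : e 1 = 0
    · have h2 : e 0 ≠ d 0 := by
        intro h2
        refine he (Finsupp.ext fun i => ?_)
        fin_cases i <;> simp [h1, h2, hd]
      have h3 : (coeff (Finsupp.single () (d 0))) ((PowerSeries.X : PowerSeries R) ^ e 0) = 0 := by
        refine (PowerSeries.coeff_X_pow _ _).trans (if_neg h2.symm)
      simp [Finsupp.prod_fintype, h1, h3]
    · simp [Finsupp.prod_fintype, h1]

/-- From `F(X, 0) = X`, the second variable divides `F - X`; by commutativity the first divides `F -
Y`. Combining the two divisibilities gives the mixed term. -/
theorem exists_eq_X_add_X_add_mul [F.IsComm] : ∃ H : MvPowerSeries (Fin 2) R,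
    F.toPowerSeries = X 0 + X 1 + X 0 * X 1 * H := by
  have h1 : X 1 ∣ F.toPowerSeries - X 0 :=
    X_dvd_iff.mpr fun d hd => F.coeff_eq_zero_of_apply_one hd
  have h2 : X 0 ∣ F.toPowerSeries - X 1 := by
    have hs : HasSubst ![(X 1 : MvPowerSeries (Fin 2) R), X 0] := HasSubst.X_X
    have h := map_dvd (substAlgHom hs) h1
    rw [map_sub] at h
    simp only [coe_substAlgHom, subst_X hs, ← IsComm.comm (F := F)] at h
    exact h
  obtain ⟨K, hK⟩ := h1
  rw [sub_eq_iff_eq_add] at hK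
  have h3 : (X 0 : MvPowerSeries (Fin 2) R) ∣ X 1 * (K - 1) := by
    have h := dvd_sub h2 (dvd_refl (X 0))
    rwa [hK, show X 1 * K + X 0 - X 1 - X 0 = (X 1 * (K - 1) : MvPowerSeries (Fin 2) R) by ring]
      at h
  have h4 : (X 0 : MvPowerSeries (Fin 2) R) ∣ K - 1 := by
    rw [X_dvd_iff] at h3 ⊢
    intro d hd
    have h := h3 (Finsupp.single 1 1 + d) (by simp [hd])
    rwa [X, coeff_add_monomial_mul, one_mul] at h
  obtain ⟨H, hH⟩ := h4
  refine ⟨H, ?_⟩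
  rw [hK, sub_eq_iff_eq_add.mp hH]
  ring

end FormalGroup

/-! ## The filtration on the formal group ring -/

namespace FormalGroupRing

open CompletedPoly

section Filtration

variable {R M : Type*} [CommRing R] [AddCommGroup M] (F : FormalGroup R)

theorem mk_surjective : Function.Surjective (mk (M := M) F) :=
  Ideal.Quotient.mkₐ_surjective R _

theorem mk_eq_zero {f : CompletedPoly M R} :
    mk F f = 0 ↔ f ∈ CompletedPoly.closure (F.relIdeal M) :=
  Ideal.Quotient.eq_zero_iff_mem

variable (M) in
/-- The image of the valuation filtration in the formal group ring. -/
noncomputable def filtration (n : ℕ) : Ideal (FormalGroupRing M F) :=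
  (valuationIdeal M R n).map (mk F)

theorem mem_filtration {n : ℕ} {u : FormalGroupRing M F} :
    u ∈ filtration M F n ↔ ∃ f ∈ valuationIdeal M R n, mk F f = u :=
  Ideal.mem_map_iff_of_surjective (mk F) (mk_surjective F)

theorem mk_mem_filtration {n : ℕ} {f : CompletedPoly M R} (hf : f ∈ valuationIdeal M R n) :
    mk F f ∈ filtration M F n :=
  (mem_filtration F).mpr ⟨f, hf, rfl⟩

theorem filtration_anti : Antitone (filtration M F) :=
  fun _ _ h => Ideal.map_mono (valuationIdeal_anti h)

theorem filtration_zero : filtration M F 0 = ⊤ := by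
  rw [filtration, valuationIdeal_zero, Ideal.map_top]

theorem mul_mem_filtration {m n : ℕ} {u v : FormalGroupRing M F}
    (hu : u ∈ filtration M F m) (hv : v ∈ filtration M F n) : u * v ∈ filtration M F (m + n) := by
  obtain ⟨f, hf, rfl⟩ := (mem_filtration F).mp hu
  obtain ⟨g, hg, rfl⟩ := (mem_filtration F).mp hv
  rw [← map_mul]
  exact mk_mem_filtration F (mul_mem_valuationIdeal hf hg)

theorem pow_mem_filtration {m : ℕ} {u : FormalGroupRing M F} (hu : u ∈ filtration M F m) (k : ℕ) :
    u ^ k ∈ filtration M F (m * k) := by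
  induction k with
  | zero => simp [filtration_zero]
  | succ k ih =>
    rw [pow_succ, mul_add, mul_one]
    exact mul_mem_filtration F ih hu

/-- The filtration is separated because the relations are divided out by the closure of the ideal.
-/
theorem eq_zero_of_forall_mem_filtration {u : FormalGroupRing M F}
    (hu : ∀ n, u ∈ filtration M F n) : u = 0 := by
  obtain ⟨f, rfl⟩ := mk_surjective F u
  rw [mk_eq_zero, CompletedPoly.closure, Ideal.mem_iInf]
  intro n
  obtain ⟨g, hg, hgf⟩ := (mem_filtration F).mp (hu n)
  rw [← sub_eq_zero, ← map_sub, mk_eq_zero, CompletedPoly.closure, Ideal.mem_iInf] at hgf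
  rw [← sub_sub_cancel g f]
  exact sub_mem (Ideal.mem_sup_right hg) (hgf n)

theorem exists_limit (u : ℕ → FormalGroupRing M F)
    (hu : ∀ n, u (n + 1) - u n ∈ filtration M F n) :
    ∃ v, ∀ n, v - u n ∈ filtration M F n := by
  choose g hg hg' using fun n => (mem_filtration F).mp (hu n)
  obtain ⟨f₀, hf₀⟩ := mk_surjective F (u 0)
  obtain ⟨f, hf⟩ := CompletedPoly.exists_limit (fun n => f₀ + ∑ i ∈ Finset.range n, g i)
    (fun n => by simpa [Finset.sum_range_succ] using hg n)
  refine ⟨mk F f, fun n => ?_⟩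
  have h : u n = mk F (f₀ + ∑ i ∈ Finset.range n, g i) := by
    rw [map_add, map_sum, hf₀, Finset.sum_congr rfl fun i _ => hg' i, Finset.sum_range_sub,
      add_sub_cancel]
  rw [h, ← map_sub]
  exact mk_mem_filtration F (hf n)

theorem mem_filtration_one {u : FormalGroupRing M F} :
    u ∈ filtration M F 1 ↔ aug M F u = 0 := by
  refine ⟨fun h => ?_, fun h => ?_⟩
  · obtain ⟨f, hf, rfl⟩ := (mem_filtration F).mp h
    exact mem_valuationIdeal_one.mp hf
  · obtain ⟨f, rfl⟩ := mk_surjective F u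
    exact mk_mem_filtration F (mem_valuationIdeal_one.mpr h)

/-- The geometric series converges. -/
theorem isUnit_one_sub {u : FormalGroupRing M F} (hu : u ∈ filtration M F 1) :
    IsUnit (1 - u) := by
  obtain ⟨v, hv⟩ := exists_limit F (fun n => ∑ i ∈ Finset.range n, u ^ i) (fun n => by
    rw [Finset.sum_range_succ, add_sub_cancel_left]
    simpa using pow_mem_filtration F hu n)
  refine IsUnit.of_mul_eq_one v (sub_eq_zero.mp (eq_zero_of_forall_mem_filtration F fun n => ?_))
  have h : (1 - u) * v - 1 = (1 - u) * (v - ∑ i ∈ Finset.range n, u ^ i) - u ^ n := by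
    rw [mul_sub, mul_neg_geom_sum]
    ring
  rw [h]
  exact sub_mem (Ideal.mul_mem_left _ _ (hv n)) (by simpa using pow_mem_filtration F hu n)

theorem isUnit_of_isUnit_aug {u : FormalGroupRing M F} (hu : IsUnit (aug M F u)) : IsUnit u := by
  obtain ⟨r, hr⟩ := hu.exists_right_inv
  have h : IsUnit (1 - (1 - u * algebraMap R _ r)) := by
    refine isUnit_one_sub F ((mem_filtration_one F).mpr ?_)
    rw [map_sub, map_one, map_mul, AlgHom.commutes, Algebra.algebraMap_self, RingHom.id_apply, hr,
      sub_self]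
  rw [sub_sub_cancel] at h
  exact isUnit_of_mul_isUnit_left h

variable {M' : Type*} [AddCommGroup M']

theorem map_mk (e : M ≃+ M') (f : CompletedPoly M R) :
    map F e (mk F f) = mk F (rename R e.toEquiv f) :=
  rfl

theorem map_mem_filtration (e : M ≃+ M') {n : ℕ} {u : FormalGroupRing M F}
    (hu : u ∈ filtration M F n) : map F e u ∈ filtration M' F n := by
  obtain ⟨f, hf, rfl⟩ := (mem_filtration F).mp hu
  rw [map_mk]
  exact mk_mem_filtration F (rename_mem_valuationIdeal _ hf)

theorem map_x (e : M ≃+ M') (m : M) : map F e (x F m) = x F (e m) := by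
  rw [x, map_mk, rename_var]
  rfl

theorem x_mem_filtration (m : M) : x F m ∈ filtration M F 1 :=
  mk_mem_filtration F (var_mem_valuationIdeal m)

theorem mk_eq_zero_of_mem_relIdeal {f : CompletedPoly M R} (hf : f ∈ F.relIdeal M) :
    mk F f = 0 := by
  rw [mk_eq_zero, CompletedPoly.closure, Ideal.mem_iInf]
  exact fun n => Ideal.mem_sup_left hf

theorem x_zero : x F (0 : M) = 0 :=
  mk_eq_zero_of_mem_relIdeal F (Ideal.subset_span (Or.inl rfl))

theorem exists_x_add [F.IsComm] (l m : M) :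
    ∃ h, x F (l + m) = x F l + x F m + x F l * x F m * h := by
  obtain ⟨H, hH⟩ := F.exists_eq_X_add_X_add_mul
  refine ⟨mk F (evalTwo H l m), ?_⟩
  have h := mk_eq_zero_of_mem_relIdeal (M := M) F (Ideal.subset_span (Or.inr ⟨l, m, rfl⟩))
  rw [map_sub, sub_eq_zero] at h
  rw [x, h, hH]
  simp only [evalTwo_add, evalTwo_mul, evalTwo_X_zero, evalTwo_X_one, map_add, map_mul]
  rfl

theorem x_dvd_x_neg [F.IsComm] (m : M) : x F m ∣ x F (-m) := by
  obtain ⟨h, hh⟩ := exists_x_add F m (-m)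
  rw [add_neg_cancel, x_zero] at hh
  exact ⟨-(1 + x F (-m) * h), by linear_combination -hh⟩

theorem x_dvd_x_add_sub [F.IsComm] (l m : M) : x F l ∣ x F (l + m) - x F m := by
  obtain ⟨h, hh⟩ := exists_x_add F l m
  exact ⟨1 + x F m * h, by rw [hh]; ring⟩

theorem x_dvd_x_zsmul [F.IsComm] (m : M) (z : ℤ) : x F m ∣ x F (z • m) := by
  induction z using Int.induction_on with
  | zero => simp [x_zero]
  | succ n ih =>
    have h := x_dvd_x_add_sub F m ((n : ℤ) • m)
    rw [add_zsmul, one_zsmul, add_comm]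
    simpa using dvd_add h ih
  | pred n ih =>
    have h := (x_dvd_x_neg F m).trans (x_dvd_x_add_sub F (-m) ((-(n : ℤ)) • m))
    have h' := dvd_add h ih
    rwa [sub_add_cancel, add_comm, ← sub_one_zsmul] at h'

theorem x_add_sub_mem [F.IsComm] (l m : M) : x F (l + m) - (x F l + x F m) ∈ filtration M F 2 := by
  obtain ⟨h, hh⟩ := exists_x_add F l m
  rw [hh, add_sub_cancel_left]
  have h2 : x F l * x F m ∈ filtration M F (1 + 1) :=
    mul_mem_filtration F (x_mem_filtration F l) (x_mem_filtration F m)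
  exact Ideal.mul_mem_right _ _ h2

/-! ### Leading forms with respect to a basis of the lattice. -/

section Basis

variable {κ : Type*} (e : Module.Basis κ ℤ M)

/-- The additive map with `e_i ↦ x_{e_i}`. -/
noncomputable def lin : M →ₗ[ℤ] FormalGroupRing M F :=
  e.constr ℤ fun i => x F (e i)

@[simp] theorem lin_basis (i : κ) : lin F e (e i) = x F (e i) :=
  e.constr_basis ℤ _ i

/-- Modulo the second step of the filtration `x` is additive, so the elements where it agrees with
`lin` form a subgroup, and this contains the basis. -/
theorem x_sub_lin_mem [F.IsComm] (m : M) : x F m - lin F e m ∈ filtration M F 2 := by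
  let H : AddSubgroup M :=
    { carrier := {m | x F m - lin F e m ∈ filtration M F 2}
      zero_mem' := by
        simp [x_zero]
      add_mem' := by
        intro l m hl hm
        have h := add_mem (x_add_sub_mem F l m) (add_mem hl hm)
        rw [Set.mem_ofPred_eq, map_add]
        convert h using 1
        ring
      neg_mem' := by
        intro m hm
        have h := x_add_sub_mem F m (-m)
        rw [add_neg_cancel, x_zero] at h
        have h' := add_mem h hm
        rw [Set.mem_ofPred_eq, map_neg]
        rw [← neg_mem_iff]
        convert h' using 1
        ring }
  have h : Submodule.span ℤ (Set.range e) ≤ AddSubgroup.toIntSubmodule H := by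
    refine Submodule.span_le.mpr ?_
    rintro _ ⟨i, rfl⟩
    change x F (e i) - lin F e (e i) ∈ filtration M F 2
    simp
  rw [e.span_eq] at h
  exact h (Submodule.mem_top (x := m))

theorem lin_mem_filtration [F.IsComm] (m : M) : lin F e m ∈ filtration M F 1 := by
  have h := sub_mem (x_mem_filtration F m) (filtration_anti F one_le_two (x_sub_lin_mem F e m))
  rwa [sub_sub_cancel] at h

/-- The algebra map from polynomials with `X_i ↦ x_{e_i}`. -/
noncomputable def polyMap : MvPolynomial κ R →ₐ[R] FormalGroupRing M F :=
  MvPolynomial.aeval fun i => x F (e i)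

theorem prod_pow_mem_filtration {τ : Type*} {a : τ → FormalGroupRing M F}
    (ha : ∀ i, a i ∈ filtration M F 1) (d : τ →₀ ℕ) :
    (d.prod fun i k => a i ^ k) ∈ filtration M F d.degree := by
  induction d using Finsupp.induction_linear with
  | zero => simp [filtration_zero]
  | add d d' h h' =>
    rw [Finsupp.prod_add_index' (by simp) (by simp [pow_add]), map_add]
    exact mul_mem_filtration F h h'
  | single i n =>
    rw [Finsupp.prod_single_index (by simp), Finsupp.degree_single]
    simpa using pow_mem_filtration F (ha i) n

theorem prod_pow_sub_mem_filtration {τ : Type*} {a c : τ → FormalGroupRing M F}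
    (ha : ∀ i, a i ∈ filtration M F 1) (hc : ∀ i, a i - c i ∈ filtration M F 2) (d : τ →₀ ℕ) :
    (d.prod fun i k => a i ^ k) - (d.prod fun i k => c i ^ k) ∈
      filtration M F (d.degree + 1) := by
  have hc' : ∀ i, c i ∈ filtration M F 1 := fun i => by
    rw [← sub_sub_cancel (a i) (c i)]
    exact sub_mem (ha i) (filtration_anti F one_le_two (hc i))
  have key : ∀ {u u' v v' : FormalGroupRing M F} {m n : ℕ}, u ∈ filtration M F m →
      v' ∈ filtration M F n → u - u' ∈ filtration M F (m + 1) → v - v' ∈ filtration M F (n + 1) →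
      u * v - u' * v' ∈ filtration M F (m + n + 1) := by
    intro u u' v v' m n hu hv' huu hvv
    have h1 := mul_mem_filtration F hu hvv
    have h2 := mul_mem_filtration F huu hv'
    rw [add_right_comm] at h2
    rw [show u * v - u' * v' = u * (v - v') + (u - u') * v' by ring]
    exact add_mem h1 h2
  induction d using Finsupp.induction_linear with
  | zero => simp
  | add d d' h h' =>
    rw [Finsupp.prod_add_index' (by simp) (by simp [pow_add]),
      Finsupp.prod_add_index' (by simp) (by simp [pow_add]), map_add]
    exact key (prod_pow_mem_filtration F ha d) (prod_pow_mem_filtration F hc' d') h h'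
  | single i n =>
    rw [Finsupp.prod_single_index (by simp), Finsupp.prod_single_index (by simp),
      Finsupp.degree_single]
    induction n with
    | zero => simp
    | succ n ih =>
      rw [pow_succ, pow_succ]
      exact key (by simpa using pow_mem_filtration F (ha i) n) (hc' i) ih (hc i)

theorem aeval_mem_filtration {τ : Type*} {a : τ → FormalGroupRing M F}
    (ha : ∀ i, a i ∈ filtration M F 1) {n : ℕ} {p : MvPolynomial τ R} (hp : p.IsHomogeneous n) :
    MvPolynomial.aeval a p ∈ filtration M F n := by
  rw [MvPolynomial.aeval_def, MvPolynomial.eval₂_eq]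
  refine sum_mem fun d hd => Ideal.mul_mem_left _ _ ?_
  rw [← hp (MvPolynomial.mem_support_iff.mp hd), Pi.one_def,
    ← Finsupp.degree_eq_weight_one]
  exact prod_pow_mem_filtration F ha d

/-- Homogeneous polynomials depend on their arguments only to first order. -/
theorem aeval_sub_aeval_mem {τ : Type*} {a c : τ → FormalGroupRing M F}
    (ha : ∀ i, a i ∈ filtration M F 1) (hc : ∀ i, a i - c i ∈ filtration M F 2) {n : ℕ}
    {p : MvPolynomial τ R} (hp : p.IsHomogeneous n) :
    MvPolynomial.aeval a p - MvPolynomial.aeval c p ∈ filtration M F (n + 1) := by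
  simp only [MvPolynomial.aeval_def, MvPolynomial.eval₂_eq]
  rw [← Finset.sum_sub_distrib]
  refine sum_mem fun d hd => ?_
  rw [← mul_sub]
  refine Ideal.mul_mem_left _ _ ?_
  rw [← hp (MvPolynomial.mem_support_iff.mp hd), Pi.one_def,
    ← Finsupp.degree_eq_weight_one]
  exact prod_pow_sub_mem_filtration F ha hc d

theorem polyMap_mem_filtration {n : ℕ} {p : MvPolynomial κ R} (hp : p.IsHomogeneous n) :
    polyMap F e p ∈ filtration M F n :=
  aeval_mem_filtration F (fun i => x_mem_filtration F (e i)) hp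

/-- The linear form `∑ λ_i X_i` attached to `λ = ∑ λ_i e_i`. -/
noncomputable def linPoly (R : Type*) [CommRing R] : M →ₗ[ℤ] MvPolynomial κ R :=
  e.constr ℤ MvPolynomial.X

theorem isHomogeneous_linPoly (m : M) : (linPoly e R m).IsHomogeneous 1 := by
  rw [linPoly, Module.Basis.constr_apply]
  refine MvPolynomial.IsHomogeneous.sum _ _ _ fun i _ => ?_
  rw [← MvPolynomial.mem_homogeneousSubmodule]
  exact zsmul_mem ((MvPolynomial.mem_homogeneousSubmodule 1 _).mpr
    (MvPolynomial.isHomogeneous_X R i)) _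

theorem polyMap_linPoly (m : M) : polyMap F e (linPoly e R m) = lin F e m := by
  have h : (polyMap F e).toLinearMap.restrictScalars ℤ ∘ₗ linPoly e R = lin F e := by
    refine e.ext fun i => ?_
    simp [linPoly, polyMap]
  exact LinearMap.congr_fun h m

/-- A leading form in all variables `x_m` is turned into one in the basis variables by replacing
`x_m` with its linear part, which changes only higher terms. -/
theorem exists_isHomogeneous_sub_polyMap_mem [F.IsComm] {n : ℕ} {u : FormalGroupRing M F}
    (hu : u ∈ filtration M F n) : ∃ p : MvPolynomial κ R, p.IsHomogeneous n ∧
      u - polyMap F e p ∈ filtration M F (n + 1) := by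
  obtain ⟨f, hf, rfl⟩ := (mem_filtration F).mp hu
  obtain ⟨q, hq, hfq⟩ := exists_isHomogeneous_sub_mem hf
  refine ⟨MvPolynomial.aeval (linPoly e R) q, ?_, ?_⟩
  · have := hq.aeval (linPoly e R) (n := 1) fun m => isHomogeneous_linPoly e m
    rwa [one_mul] at this
  · have h1 : mk F (ofPoly M R q) = MvPolynomial.aeval (x F) q := by
      rw [ofPoly, ← AlgHom.comp_apply, MvPolynomial.comp_aeval]
      rfl
    have h2 : polyMap F e (MvPolynomial.aeval (linPoly e R) q) =
        MvPolynomial.aeval (lin F e) q := by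
      rw [← AlgHom.comp_apply, MvPolynomial.comp_aeval]
      exact congrArg (fun a => MvPolynomial.aeval a q) (funext fun m => polyMap_linPoly F e m)
    have h3 := mk_mem_filtration F hfq
    rw [map_sub, h1] at h3
    rw [h2]
    have h4 := aeval_sub_aeval_mem F (x_mem_filtration F) (x_sub_lin_mem F e) hq
    rw [← sub_add_sub_cancel]
    exact add_mem h3 h4

end Basis

end Filtration

end FormalGroupRing

/-! ## The order filtration on power series -/

namespace MvPowerSeries

section OrderIdeal

variable {σ τ R : Type*} [CommRing R]

/-- The ideal of power series of order at least `n`. -/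
noncomputable def orderIdeal (σ R : Type*) [CommRing R] (n : ℕ) : Ideal (MvPowerSeries σ R) where
  carrier := {f | (n : ℕ∞) ≤ f.order}
  zero_mem' := by simp
  add_mem' := fun hf hg => (le_min hf hg).trans min_order_le_add
  smul_mem' := fun _ _ hf => hf.trans (le_add_self.trans le_order_mul)

theorem mem_orderIdeal {n : ℕ} {f : MvPowerSeries σ R} :
    f ∈ orderIdeal σ R n ↔ (n : ℕ∞) ≤ f.order :=
  Iff.rfl

theorem mem_orderIdeal_iff_coeff {n : ℕ} {f : MvPowerSeries σ R} :
    f ∈ orderIdeal σ R n ↔ ∀ d : σ →₀ ℕ, d.degree < n → coeff d f = 0 :=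
  ⟨fun h _ hd => coeff_of_lt_order ((Nat.cast_lt.mpr hd).trans_le h), fun h => nat_le_order h⟩

theorem mem_orderIdeal_one {f : MvPowerSeries σ R} :
    f ∈ orderIdeal σ R 1 ↔ constantCoeff f = 0 :=
  one_le_order_iff_constCoeff_eq_zero

theorem mul_mem_orderIdeal {m n : ℕ} {f g : MvPowerSeries σ R} (hf : f ∈ orderIdeal σ R m)
    (hg : g ∈ orderIdeal σ R n) : f * g ∈ orderIdeal σ R (m + n) := by
  rw [mem_orderIdeal, Nat.cast_add]
  exact (add_le_add hf hg).trans le_order_mul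

theorem orderIdeal_anti : Antitone (orderIdeal σ R) :=
  fun _ _ h _ hf => le_trans (Nat.cast_le.mpr h) (mem_orderIdeal.mp hf)

theorem eq_of_forall_sub_mem_orderIdeal {f g : MvPowerSeries σ R}
    (h : ∀ n, f - g ∈ orderIdeal σ R n) : f = g := by
  ext d
  rw [← sub_eq_zero, ← map_sub]
  exact mem_orderIdeal_iff_coeff.mp (h (d.degree + 1)) d (Nat.lt_succ_self _)

theorem exists_limit (f : ℕ → MvPowerSeries σ R)
    (hf : ∀ n, f (n + 1) - f n ∈ orderIdeal σ R n) :
    ∃ g, ∀ n, g - f n ∈ orderIdeal σ R n := by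
  have hf' : ∀ m n, m ≤ n → f n - f m ∈ orderIdeal σ R m := by
    intro m n h
    induction n, h using Nat.le_induction with
    | base => simp
    | succ n h ih =>
      rw [← sub_add_sub_cancel _ (f n)]
      exact add_mem (orderIdeal_anti h (hf n)) ih
  let g : MvPowerSeries σ R := fun d => coeff d (f (d.degree + 1))
  have hg : ∀ d, coeff d g = coeff d (f (d.degree + 1)) := fun d => rfl
  refine ⟨g, fun n => mem_orderIdeal_iff_coeff.mpr fun d hd => ?_⟩
  have h := mem_orderIdeal_iff_coeff.mp (hf' (d.degree + 1) n hd) d (Nat.lt_succ_self _)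
  rw [map_sub, sub_eq_zero] at h
  rw [map_sub, hg, h, sub_self]

theorem aeval_mem_orderIdeal {a : τ → MvPowerSeries σ R} (ha : ∀ i, constantCoeff (a i) = 0)
    {n : ℕ} {p : MvPolynomial τ R} (hp : ∀ d : τ →₀ ℕ, d.degree < n → p.coeff d = 0) :
    MvPolynomial.aeval a p ∈ orderIdeal σ R n := by
  rw [MvPolynomial.aeval_def, MvPolynomial.eval₂_eq]
  refine sum_mem fun d hd => Ideal.mul_mem_left _ _ ?_
  have hn : n ≤ d.degree := by
    by_contra h
    exact MvPolynomial.mem_support_iff.mp hd (hp d (not_le.mp h))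
  refine orderIdeal_anti hn ((le_trans ?_ (le_order_prod _ _) : _ ≤ _))
  rw [Finsupp.degree_apply, Nat.cast_sum]
  exact Finset.sum_le_sum fun i _ => le_order_pow_of_constantCoeff_eq_zero _ (ha i)

theorem subst_mem_orderIdeal [Finite τ] {a : τ → MvPowerSeries σ R}
    (ha : ∀ i, constantCoeff (a i) = 0) {n : ℕ} {f : MvPowerSeries τ R}
    (hf : f ∈ orderIdeal τ R n) : f.subst a ∈ orderIdeal σ R n := by
  refine le_trans ?_ (le_order_subst (hasSubst_of_constantCoeff_zero ha) f)
  refine le_trans hf (le_mul_of_one_le_left' ?_)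
  exact le_iInf fun i => one_le_order_iff_constCoeff_eq_zero.mpr (ha i)

theorem sub_truncTotal_mem_orderIdeal [Finite τ] (f : MvPowerSeries τ R) (n : ℕ) :
    f - (truncTotal n f : MvPolynomial τ R) ∈ orderIdeal τ R n := by
  refine mem_orderIdeal_iff_coeff.mpr fun d hd => ?_
  rw [map_sub, MvPolynomial.coeff_coe, coeff_truncTotal f hd, sub_self]

theorem subst_sub_aeval_truncTotal_mem [Finite τ] {a : τ → MvPowerSeries σ R}
    (ha : ∀ i, constantCoeff (a i) = 0) (f : MvPowerSeries τ R) (n : ℕ) :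
    f.subst a - MvPolynomial.aeval a (truncTotal n f) ∈ orderIdeal σ R n := by
  rw [← subst_coe, ← subst_sub (hasSubst_of_constantCoeff_zero ha)]
  exact subst_mem_orderIdeal ha (sub_truncTotal_mem_orderIdeal f n)

theorem subst_sub_subst_mem [Finite τ] {a c : τ → MvPowerSeries σ R}
    (ha : ∀ i, constantCoeff (a i) = 0) (hc : ∀ i, constantCoeff (c i) = 0) {n : ℕ}
    (h : ∀ i, a i - c i ∈ orderIdeal σ R n) (f : MvPowerSeries τ R) :
    f.subst a - f.subst c ∈ orderIdeal σ R n := by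
  have h1 := subst_sub_aeval_truncTotal_mem ha f n
  have h2 := subst_sub_aeval_truncTotal_mem hc f n
  have h3 : MvPolynomial.aeval a (truncTotal n f) - MvPolynomial.aeval c (truncTotal n f) ∈
      orderIdeal σ R n := by
    rw [← Ideal.Quotient.eq, ← Ideal.Quotient.mkₐ_eq_mk R, ← AlgHom.comp_apply,
      ← AlgHom.comp_apply, MvPolynomial.comp_aeval, MvPolynomial.comp_aeval]
    congr 2
    exact funext fun i => Ideal.Quotient.eq.mpr (h i)
  have := add_mem h1 (sub_mem h3 h2)
  convert this using 1
  ring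

end OrderIdeal

end MvPowerSeries

/-! ## The group of points of a formal group law -/

namespace FormalGroup

open MvPowerSeries

section Points

variable {R : Type*} [CommRing R] (F : FormalGroup R) {κ : Type*}

theorem hasSubst_of_constantCoeff {f : MvPowerSeries κ R} (hf : constantCoeff f = 0) :
    PowerSeries.HasSubst f :=
  PowerSeries.HasSubst.of_constantCoeff_zero hf

theorem constantCoeff_pair {f g : MvPowerSeries κ R} (hf : constantCoeff f = 0)
    (hg : constantCoeff g = 0) (i : Fin 2) : constantCoeff (![f, g] i) = 0 := by
  fin_cases i
  · exact hf
  · exact hg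

theorem constantCoeff_subst_pair {f g : MvPowerSeries κ R} (hf : constantCoeff f = 0)
    (hg : constantCoeff g = 0) : constantCoeff (F.toPowerSeries.subst ![f, g]) = 0 :=
  constantCoeff_subst_eq_zero (hasSubst_of_constantCoeff_zero (constantCoeff_pair hf hg))
    (constantCoeff_pair hf hg) F.zero_constantCoeff

/-- Writing `F = X + Y + XY·H`, the equation `F(f, g) = 0` becomes the fixed point equation `g = -f
- f g H(f, g)`. Its right side is contracting in `g` because `f` has no constant term. -/
theorem exists_subst_pair_eq_zero [F.IsComm] {f : MvPowerSeries κ R} (hf : constantCoeff f = 0) :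
    ∃ g : MvPowerSeries κ R, constantCoeff g = 0 ∧ F.toPowerSeries.subst ![f, g] = 0 := by
  obtain ⟨H, hH⟩ := F.exists_eq_X_add_X_add_mul
  let T : MvPowerSeries κ R → MvPowerSeries κ R := fun g => -f - f * g * H.subst ![f, g]
  have hF : ∀ g : MvPowerSeries κ R, constantCoeff g = 0 →
      F.toPowerSeries.subst ![f, g] = g - T g := by
    intro g hg
    have hs := hasSubst_of_constantCoeff_zero (constantCoeff_pair hf hg)
    rw [hH, subst_add hs, subst_add hs, subst_mul hs, subst_mul hs, subst_X hs, subst_X hs]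
    simp only [T, Matrix.cons_val_zero, Matrix.cons_val_one]
    ring
  have hT0 : ∀ g, constantCoeff (T g) = 0 := by
    intro g
    simp [T, hf]
  have hT : ∀ (n : ℕ) (g h : MvPowerSeries κ R), constantCoeff g = 0 → constantCoeff h = 0 →
      g - h ∈ orderIdeal κ R n → T g - T h ∈ orderIdeal κ R (n + 1) := by
    intro n g h hg hh hgh
    have h1 := subst_sub_subst_mem (constantCoeff_pair hf hg) (constantCoeff_pair hf hh) (n := n)
      (by
        intro i
        fin_cases i
        · simp
        · exact hgh) H
    have h2 : g * (H.subst ![f, g] - H.subst ![f, h]) + (g - h) * H.subst ![f, h] ∈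
        orderIdeal κ R n :=
      add_mem (Ideal.mul_mem_left _ _ h1) (Ideal.mul_mem_right _ _ hgh)
    have h3 := neg_mem (mul_mem_orderIdeal h2 (mem_orderIdeal_one.mpr hf))
    convert h3 using 1
    simp only [T]
    ring
  let u : ℕ → MvPowerSeries κ R := fun n => T^[n] 0
  have hu0 : ∀ n, constantCoeff (u n) = 0 := by
    intro n
    cases n with
    | zero => simp [u]
    | succ n =>
      simp only [u, Function.iterate_succ_apply']
      exact hT0 _
  have hu : ∀ n, u (n + 1) - u n ∈ orderIdeal κ R n := by
    intro n
    induction n with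
    | zero => exact mem_orderIdeal.mpr (by simp)
    | succ n ih =>
      have := hT n _ _ (hu0 _) (hu0 _) ih
      simpa only [u, ← Function.iterate_succ_apply'] using this
  obtain ⟨g, hg⟩ := exists_limit u hu
  have hg0 : constantCoeff g = 0 := by
    have h := mem_orderIdeal_one.mp (hg 1)
    rwa [map_sub, hu0, sub_zero] at h
  refine ⟨g, hg0, ?_⟩
  rw [hF g hg0, sub_eq_zero]
  refine eq_of_forall_sub_mem_orderIdeal fun n => ?_
  have h1 := orderIdeal_anti (Nat.le_succ n) (hg (n + 1))
  have h2 := orderIdeal_anti (Nat.le_succ n) (hT n _ _ hg0 (hu0 _) (hg n))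
  have h3 : T (u n) = u (n + 1) := (Function.iterate_succ_apply' T n 0).symm
  rw [h3] at h2
  simpa using sub_mem h1 h2

/-- The power series with vanishing constant coefficient, as points of the formal group law. -/
@[ext]
structure ZeroPoint (F : FormalGroup R) (κ : Type*) where
  /-- The underlying power series. -/
  val : MvPowerSeries κ R
  constantCoeff_val : constantCoeff val = 0

namespace ZeroPoint

noncomputable instance : Add (F.ZeroPoint κ) where
  add f g := ⟨F.toPowerSeries.subst ![f.val, g.val],
    F.constantCoeff_subst_pair f.constantCoeff_val g.constantCoeff_val⟩

noncomputable instance : Zero (F.ZeroPoint κ) where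
  zero := ⟨0, map_zero _⟩

noncomputable instance [F.IsComm] : Neg (F.ZeroPoint κ) where
  neg f := ⟨(F.exists_subst_pair_eq_zero f.constantCoeff_val).choose,
    (F.exists_subst_pair_eq_zero f.constantCoeff_val).choose_spec.1⟩

theorem hasSubst (f : F.ZeroPoint κ) : PowerSeries.HasSubst f.val :=
  hasSubst_of_constantCoeff f.constantCoeff_val

noncomputable instance [F.IsComm] : AddCommGroup (F.ZeroPoint κ) where
  add_assoc f g h := ZeroPoint.ext (F.assoc' f.hasSubst g.hasSubst h.hasSubst)
  zero_add f := ZeroPoint.ext (F.zero_add f.hasSubst)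
  add_zero f := ZeroPoint.ext (F.add_zero f.hasSubst)
  add_comm f g := ZeroPoint.ext (F.comm' f.hasSubst g.hasSubst)
  neg_add_cancel f := ZeroPoint.ext ((F.comm' (-f).hasSubst f.hasSubst).trans
    (F.exists_subst_pair_eq_zero f.constantCoeff_val).choose_spec.2)
  nsmul := nsmulRec
  zsmul := zsmulRec

end ZeroPoint

variable {F} in
theorem ZeroPoint.coe_add [F.IsComm] (f g : F.ZeroPoint κ) :
    (f + g).val = F.toPowerSeries.subst ![f.val, g.val] :=
  rfl

/-- The homomorphism to the points of the formal group law sending `e_i` to `X_i`. -/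
noncomputable def basisPoint [F.IsComm] {M : Type*} [AddCommGroup M] (e : Module.Basis κ ℤ M) :
    M →ₗ[ℤ] F.ZeroPoint κ :=
  e.constr ℤ fun i => ⟨X i, constantCoeff_X i⟩

theorem basisPoint_basis [F.IsComm] {M : Type*} [AddCommGroup M] (e : Module.Basis κ ℤ M) (i : κ) :
    (F.basisPoint e (e i)).val = X i := by
  rw [basisPoint, e.constr_basis]

end Points

end FormalGroup

/-! ## Evaluation of completed polynomials -/

namespace CompletedPoly

open MvPowerSeries

section Eval

variable {S R κ : Type*} [CommRing R] (a : S → MvPowerSeries κ R)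

/-- The value at `a` of a series, for `a` with vanishing constant coefficients. -/
noncomputable def evalFun (f : CompletedPoly S R) : MvPowerSeries κ R :=
  fun d => coeff d (MvPolynomial.aeval a (exists_sub_ofPoly_mem f (d.degree + 1)).choose)

variable {a} (ha : ∀ s, constantCoeff (a s) = 0)
include ha

/-- The chosen approximations do not matter: two polynomials close to `f` have close values, as the
arguments have no constant term. -/
theorem evalFun_sub_aeval_mem {f : CompletedPoly S R} {n : ℕ} {p : MvPolynomial S R}
    (hp : f - ofPoly S R p ∈ valuationIdeal S R n) :
    evalFun a f - MvPolynomial.aeval a p ∈ orderIdeal κ R n := by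
  refine mem_orderIdeal_iff_coeff.mpr fun d hd => ?_
  have hq := (exists_sub_ofPoly_mem f (d.degree + 1)).choose_spec
  set q := (exists_sub_ofPoly_mem f (d.degree + 1)).choose with hq'
  have h1 : ofPoly S R (q - p) ∈ valuationIdeal S R (d.degree + 1) := by
    rw [map_sub, ← sub_sub_sub_cancel_left _ _ f]
    exact sub_mem (valuationIdeal_anti hd hp) hq
  have h2 := mem_orderIdeal_iff_coeff.mp
    (aeval_mem_orderIdeal ha (ofPoly_mem_valuationIdeal.mp h1)) d (Nat.lt_succ_self _)
  rwa [map_sub, map_sub] at h2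

theorem evalFun_ofPoly (p : MvPolynomial S R) :
    evalFun a (ofPoly S R p) = MvPolynomial.aeval a p :=
  eq_of_forall_sub_mem_orderIdeal fun n => evalFun_sub_aeval_mem ha (n := n) (by simp)

theorem evalFun_mem_orderIdeal {f : CompletedPoly S R} {n : ℕ} (hf : f ∈ valuationIdeal S R n) :
    evalFun a f ∈ orderIdeal κ R n := by
  simpa using evalFun_sub_aeval_mem ha (p := 0) (by simpa using hf)

/-- The algebra map `R⟦x_S⟧ → R⟦X⟧` sending `x_s` to the power series `a_s` with vanishing constant
coefficient. -/
noncomputable def evalHom : CompletedPoly S R →ₐ[R] MvPowerSeries κ R where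
  toFun := evalFun a
  map_one' := by simpa using evalFun_ofPoly ha 1
  map_zero' := by simpa using evalFun_ofPoly ha 0
  map_mul' f g := by
    refine eq_of_forall_sub_mem_orderIdeal fun n => ?_
    obtain ⟨p, hp⟩ := exists_sub_ofPoly_mem f n
    obtain ⟨q, hq⟩ := exists_sub_ofPoly_mem g n
    have h : f * g - ofPoly S R (p * q) ∈ valuationIdeal S R n := by
      rw [map_mul, show f * g - ofPoly S R p * ofPoly S R q =
        (f - ofPoly S R p) * g + ofPoly S R p * (g - ofPoly S R q) by ring]
      exact add_mem (Ideal.mul_mem_right _ _ hp) (Ideal.mul_mem_left _ _ hq)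
    have h1 := evalFun_sub_aeval_mem ha h
    rw [map_mul] at h1
    have h2 := Ideal.mul_mem_right (evalFun a g) _ (evalFun_sub_aeval_mem ha hp)
    have h3 := Ideal.mul_mem_left _ (MvPolynomial.aeval a p) (evalFun_sub_aeval_mem ha hq)
    convert sub_mem h1 (add_mem h2 h3) using 1
    ring
  map_add' f g := by
    refine eq_of_forall_sub_mem_orderIdeal fun n => ?_
    obtain ⟨p, hp⟩ := exists_sub_ofPoly_mem f n
    obtain ⟨q, hq⟩ := exists_sub_ofPoly_mem g n
    have h : f + g - ofPoly S R (p + q) ∈ valuationIdeal S R n := by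
      rw [map_add, add_sub_add_comm]
      exact add_mem hp hq
    have h1 := evalFun_sub_aeval_mem ha h
    rw [map_add] at h1
    convert sub_mem h1 (add_mem (evalFun_sub_aeval_mem ha hp) (evalFun_sub_aeval_mem ha hq)) using 1
    ring
  commutes' r := by
    have h := evalFun_ofPoly ha (MvPolynomial.C r)
    rwa [← MvPolynomial.algebraMap_eq, AlgHom.commutes, AlgHom.commutes] at h

theorem evalHom_ofPoly (p : MvPolynomial S R) :
    evalHom ha (ofPoly S R p) = MvPolynomial.aeval a p :=
  evalFun_ofPoly ha p

theorem evalHom_var (s : S) : evalHom ha (var R s) = a s := by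
  have h := evalHom_ofPoly ha (MvPolynomial.X s)
  rwa [ofPoly, MvPolynomial.aeval_X, MvPolynomial.aeval_X] at h

/-- For truncations of `G` this is an identity of polynomials, and the tails lie arbitrarily deep in
the order filtration. -/
theorem evalHom_evalTwo (G : MvPowerSeries (Fin 2) R) (s t : S) :
    evalHom ha (evalTwo G s t) = G.subst ![a s, a t] := by
  refine eq_of_forall_sub_mem_orderIdeal fun n => ?_
  have h1 : evalTwo (truncTotal n G : MvPolynomial (Fin 2) R) s t =
      MvPolynomial.aeval ![var R s, var R t] (truncTotal n G) := by
    refine Subtype.ext ?_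
    change subst _ _ = (CompletedPoly S R).val _
    rw [subst_coe, ← AlgHom.comp_apply, MvPolynomial.comp_aeval]
    congr 2
    funext i
    fin_cases i <;> rfl
  have h2 : evalHom ha (MvPolynomial.aeval ![var R s, var R t] (truncTotal n G)) =
      MvPolynomial.aeval ![a s, a t] (truncTotal n G) := by
    rw [← AlgHom.comp_apply, MvPolynomial.comp_aeval]
    congr 2
    funext i
    fin_cases i <;> simp [evalHom_var]
  have h3 : evalTwo G s t - evalTwo (truncTotal n G : MvPolynomial (Fin 2) R) s t ∈
      valuationIdeal S R n := by
    have h := subst_mem_orderIdeal (a := ![(X s : MvPowerSeries S R), X t])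
      (FormalGroup.constantCoeff_pair (constantCoeff_X s) (constantCoeff_X t))
      (sub_truncTotal_mem_orderIdeal G n)
    rw [subst_sub HasSubst.X_X] at h
    exact mem_orderIdeal_iff_coeff.mp h
  have h4 : evalHom ha _ ∈ _ := evalFun_mem_orderIdeal ha h3
  rw [map_sub, h1, h2] at h4
  have h5 := subst_sub_aeval_truncTotal_mem (FormalGroup.constantCoeff_pair (ha s) (ha t)) G n
  simpa using sub_mem h4 h5

end Eval

end CompletedPoly

/-! ### The map to power series and uniqueness of leading forms. -/

namespace FormalGroupRing

open CompletedPoly MvPowerSeries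

section ToPowerSeries

variable {R M : Type*} [CommRing R] [AddCommGroup M] (F : FormalGroup R) [F.IsComm]
variable {κ : Type*} (e : Module.Basis κ ℤ M)

theorem evalHom_basisPoint_eq_zero {f : CompletedPoly M R}
    (hf : f ∈ CompletedPoly.closure (F.relIdeal M)) :
    evalHom (fun m => (F.basisPoint e m).constantCoeff_val) f = 0 := by
  have hrel : F.relIdeal M ≤ RingHom.ker (evalHom (fun m => (F.basisPoint e m).constantCoeff_val)) := by
    refine Ideal.span_le.mpr ?_
    rintro f (hf | ⟨l, m, rfl⟩)
    · rw [Set.mem_singleton_iff] at hf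
      subst hf
      change evalHom _ _ = 0
      rw [evalHom_var, map_zero]
      rfl
    · change evalHom _ _ = 0
      rw [map_sub, evalHom_var, evalHom_evalTwo, map_add, FormalGroup.ZeroPoint.coe_add, sub_self]
  rw [CompletedPoly.closure, Ideal.mem_iInf] at hf
  refine eq_of_forall_sub_mem_orderIdeal fun n => ?_
  rw [sub_zero]
  obtain ⟨g, hg, h, hh, rfl⟩ := Submodule.mem_sup.mp (hf n)
  rw [map_add, show evalHom _ g = 0 from hrel hg, zero_add]
  exact evalFun_mem_orderIdeal (fun m => (F.basisPoint e m).constantCoeff_val) hh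

/-- The algebra map to power series with `x_{e_i} ↦ X_i`. -/
noncomputable def toPowerSeries : FormalGroupRing M F →ₐ[R] MvPowerSeries κ R :=
  Ideal.Quotient.liftₐ (CompletedPoly.closure (F.relIdeal M))
    (evalHom fun m => (F.basisPoint e m).constantCoeff_val) fun _ hf => evalHom_basisPoint_eq_zero F e hf

theorem toPowerSeries_mk (f : CompletedPoly M R) :
    toPowerSeries F e (mk F f) = evalHom (fun m => (F.basisPoint e m).constantCoeff_val) f :=
  rfl

theorem toPowerSeries_mem_orderIdeal {n : ℕ} {u : FormalGroupRing M F}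
    (hu : u ∈ filtration M F n) : toPowerSeries F e u ∈ orderIdeal κ R n := by
  obtain ⟨f, hf, rfl⟩ := (mem_filtration F).mp hu
  exact evalFun_mem_orderIdeal (fun m => (F.basisPoint e m).constantCoeff_val) hf

theorem toPowerSeries_polyMap (p : MvPolynomial κ R) :
    toPowerSeries F e (polyMap F e p) = (p : MvPowerSeries κ R) := by
  have h : (toPowerSeries F e).comp (polyMap F e) = MvPolynomial.coeToMvPowerSeries.algHom R := by
    refine MvPolynomial.algHom_ext fun i => ?_
    rw [AlgHom.comp_apply, polyMap, MvPolynomial.aeval_X, x, toPowerSeries_mk, evalHom_var,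
      F.basisPoint_basis]
    simp
  simpa using DFunLike.congr_fun h p

/-- The map to power series sends `polyMap F e p` to `p` itself and does not lower the order. This
makes leading forms unique. -/
theorem eq_zero_of_polyMap_mem {n : ℕ} {p : MvPolynomial κ R} (hp : p.IsHomogeneous n)
    (h : polyMap F e p ∈ filtration M F (n + 1)) : p = 0 := by
  have h1 := toPowerSeries_mem_orderIdeal F e h
  rw [toPowerSeries_polyMap, mem_orderIdeal_iff_coeff] at h1
  ext d
  by_cases hd : d.degree = n
  · simpa using h1 d (by omega)
  · rw [hp.coeff_eq_zero hd, MvPolynomial.coeff_zero]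

end ToPowerSeries

/-! ### Regularity of `x` and divisibility by it. -/

section Regular

variable {R M : Type*} [CommRing R] [AddCommGroup M]
variable {κ : Type*} (e : Module.Basis κ ℤ M)

/-- Translate the variables by `X_i ↦ X_i + c(e_i) T`. The linear form of `m` becomes itself plus
`2T`, and the top coefficient in `T` of the product is twice that of the translate of `p`. -/
theorem eq_zero_of_linPoly_mul_eq_zero (h2 : ∀ r : R, 2 * r = 0 → r = 0) {m : M}
    (c : M →ₗ[ℤ] ℤ) (hc : c m = 2) {p : MvPolynomial κ R} (hp : linPoly e R m * p = 0) :
    p = 0 := by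
  let T : MvPolynomial κ R →ₐ[R] Polynomial (MvPolynomial κ R) :=
    MvPolynomial.aeval fun i => Polynomial.C (MvPolynomial.X i) + (c (e i) : ℤ) • Polynomial.X
  have hlin : ∀ l, T (linPoly e R l) = Polynomial.C (linPoly e R l) + (c l : ℤ) • Polynomial.X := by
    intro l
    have h : T.toLinearMap.restrictScalars ℤ ∘ₗ linPoly e R =
        ((Polynomial.C : MvPolynomial κ R →+* _).toAddMonoidHom.toIntLinearMap ∘ₗ linPoly e R) +
          c.smulRight (Polynomial.X : Polynomial (MvPolynomial κ R)) := by
      refine e.ext fun i => ?_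
      simp [linPoly, T]
    exact LinearMap.congr_fun h l
  have heval : ∀ q, Polynomial.eval 0 (T q) = q := by
    intro q
    have h : (Polynomial.aeval (R := MvPolynomial κ R) (0 : MvPolynomial κ R)).toRingHom.comp
        T.toRingHom = RingHom.id _ := by
      refine MvPolynomial.ringHom_ext (fun r => ?_) fun i => ?_
      · simp [T]
      · simp [T]
    simpa using DFunLike.congr_fun h q
  have h1 : T (linPoly e R m) * T p = 0 := by rw [← map_mul, hp, map_zero]
  rw [hlin, hc] at h1
  have h3 : T p = 0 := by
    by_contra hne
    have h4 := congrArg (Polynomial.coeff · ((T p).natDegree + 1)) h1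
    simp only [add_mul, Polynomial.coeff_add, Polynomial.coeff_C_mul, smul_mul_assoc,
      Polynomial.coeff_smul, Polynomial.coeff_X_mul, Polynomial.coeff_zero,
      Polynomial.coeff_eq_zero_of_natDegree_lt (Nat.lt_succ_self _), mul_zero, zero_add] at h4
    refine hne (Polynomial.leadingCoeff_eq_zero.mp ?_)
    ext d
    have h5 := congrArg (MvPolynomial.coeff d) h4
    rw [MvPolynomial.coeff_smul, MvPolynomial.coeff_zero, zsmul_eq_mul] at h5
    exact h2 _ (by exact_mod_cast h5)
  rw [← heval p, h3, Polynomial.eval_zero]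

variable (F : FormalGroup R) [F.IsComm] (h2 : ∀ r : R, 2 * r = 0 → r = 0) {m : M}
  (c : M →ₗ[ℤ] ℤ) (hc : c m = 2)
include e h2 hc

/-- The leading form of `x_m u` is the linear form of `m` times that of `u`. A product that is too
small forces the leading form of `u` to vanish. -/
theorem mem_filtration_of_x_mul_mem {n : ℕ} {u : FormalGroupRing M F}
    (hu : x F m * u ∈ filtration M F (n + 1)) : u ∈ filtration M F n := by
  induction n with
  | zero => simp [filtration_zero]
  | succ n ih =>
    obtain ⟨p, hp, hup⟩ := exists_isHomogeneous_sub_polyMap_mem F e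
      (ih (filtration_anti F (Nat.le_succ _) hu))
    have h1 : polyMap F e (linPoly e R m * p) ∈ filtration M F (n + 1 + 1) := by
      rw [map_mul, polyMap_linPoly]
      have h3 := mul_mem_filtration F (x_mem_filtration F m) hup
      have h4 := mul_mem_filtration F (x_sub_lin_mem F e m) (polyMap_mem_filtration F e hp)
      rw [add_comm 1] at h3
      rw [show 2 + n = n + 1 + 1 by ring] at h4
      convert sub_mem (sub_mem hu h3) h4 using 1
      ring
    have h5 := (isHomogeneous_linPoly e m (R := R)).mul hp
    rw [add_comm 1] at h5
    have h6 := eq_zero_of_polyMap_mem F e h5 h1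
    rw [eq_zero_of_linPoly_mul_eq_zero e h2 c hc h6, map_zero, sub_zero] at hup
    exact hup

theorem isLeftRegular_x : IsLeftRegular (x F m) := by
  refine isLeftRegular_iff_right_eq_zero_of_mul.mpr fun u hu => ?_
  refine eq_zero_of_forall_mem_filtration F fun n => ?_
  exact mem_filtration_of_x_mul_mem e F h2 c hc (by rw [hu]; exact zero_mem _)

/-- The principal ideal of `x_m` is closed: cancelling `x_m` costs one degree, so the approximate
quotients form a Cauchy sequence. -/
theorem x_dvd_of_forall_exists {u : FormalGroupRing M F}
    (hu : ∀ n, ∃ v, u - x F m * v ∈ filtration M F n) : x F m ∣ u := by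
  choose v hv using hu
  obtain ⟨w, hw⟩ := exists_limit F (fun n => v (n + 1)) fun n => by
    refine mem_filtration_of_x_mul_mem e F h2 c hc ?_
    have h1 := filtration_anti F (Nat.le_succ _) (hv (n + 1 + 1))
    convert sub_mem (hv (n + 1)) h1 using 1
    ring
  refine ⟨w, sub_eq_zero.mp (eq_zero_of_forall_mem_filtration F fun n => ?_)⟩
  have h1 := Ideal.mul_mem_left _ (x F m) (hw n)
  have h3 := filtration_anti F (Nat.le_succ _) (hv (n + 1))
  convert sub_mem h3 h1 using 1
  ring

/-- The product rule for `u - s(u)` reduces polynomials to the variables, where `l - s(l)` is a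
multiple of `m`. Polynomials are dense and the ideal is closed. -/
theorem x_dvd_sub_map (s : M ≃+ M) (hs : ∀ l, ∃ z : ℤ, l = z • m + s l)
    (u : FormalGroupRing M F) : x F m ∣ u - map F s u := by
  have hpoly : ∀ p : MvPolynomial M R,
      x F m ∣ mk F (ofPoly M R p) - map F s (mk F (ofPoly M R p)) := by
    intro p
    induction p using MvPolynomial.induction_on with
    | C r =>
      rw [← MvPolynomial.algebraMap_eq, AlgHom.commutes, AlgHom.commutes, AlgHom.commutes, sub_self]
      exact dvd_zero _
    | add p q hp hq =>
      rw [map_add, map_add, map_add, add_sub_add_comm]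
      exact dvd_add hp hq
    | mul_X p l hp =>
      have hl : mk F (ofPoly M R (MvPolynomial.X l)) = x F l := by
        rw [ofPoly, MvPolynomial.aeval_X]
        rfl
      rw [map_mul, map_mul, map_mul, hl, map_x]
      obtain ⟨z, hz⟩ := hs l
      have h1 := (x_dvd_x_zsmul F m z).trans (x_dvd_x_add_sub F (z • m) (s l))
      rw [← hz] at h1
      have h3 := dvd_add (hp.mul_right (x F l))
        (h1.mul_left (map F s (mk F (ofPoly M R p))))
      convert h3 using 1
      ring
  refine x_dvd_of_forall_exists e F h2 c hc fun n => ?_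
  obtain ⟨f, rfl⟩ := mk_surjective F u
  obtain ⟨p, hp⟩ := exists_sub_ofPoly_mem f n
  obtain ⟨v, hv⟩ := hpoly p
  refine ⟨v, ?_⟩
  rw [← hv]
  have h3 := mk_mem_filtration F hp
  have h4 := map_mem_filtration F s h3
  rw [map_sub] at h3 h4
  convert sub_mem h3 h4 using 1
  rw [map_sub]
  ring

end Regular

end FormalGroupRing

/-! ## The Weyl group action on the formal group ring -/

namespace FormalGroupRing

variable {R M M' M'' : Type*} [CommRing R] [AddCommGroup M] [AddCommGroup M'] [AddCommGroup M'']
  (F : FormalGroup R)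

theorem map_trans (e : M ≃+ M') (e' : M' ≃+ M'') (u : FormalGroupRing M F) :
    map F (e.trans e') u = map F e' (map F e u) := by
  obtain ⟨f, rfl⟩ := mk_surjective F u
  rw [map_mk, map_mk, map_mk]
  exact congrArg (mk F) (Subtype.ext (MvPowerSeries.rename_rename e.toEquiv e'.toEquiv _).symm)

theorem map_refl (u : FormalGroupRing M F) : map F (AddEquiv.refl M) u = u := by
  obtain ⟨f, rfl⟩ := mk_surjective F u
  rw [map_mk]
  exact congrArg (mk F) (Subtype.ext (MvPowerSeries.rename_id_apply _))

end FormalGroupRing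

namespace RootPairing

open FormalGroupRing

/-! ### Divided differences on the formal group ring and the formal inclusion. -/

section Delta

variable {ι M N R : Type*} [AddCommGroup M] [AddCommGroup N] [CommRing R]
  (P : RootDatum ι M N) (F : FormalGroup R)

theorem weylAct_mul (v w : P.weylGroup) (u : FormalGroupRing M F) :
    P.weylAct F (v * w) u = P.weylAct F v (P.weylAct F w u) := by
  rw [weylAct, weylAct, weylAct, ← map_trans]
  exact congrArg (fun e => map F e u) (AddEquiv.ext fun m => mul_smul v w m)

theorem weylAct_one (u : FormalGroupRing M F) : P.weylAct F 1 u = u := by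
  rw [weylAct]
  refine (congrArg (fun e => map F e u) (AddEquiv.ext fun m => ?_)).trans (map_refl F u)
  exact one_smul P.weylGroup m

theorem weylAct_x (w : P.weylGroup) (m : M) : P.weylAct F w (x F m) = x F (w • m) :=
  map_x F _ m

theorem weylAct_mem_filtration (w : P.weylGroup) {n : ℕ} {u : FormalGroupRing M F}
    (hu : u ∈ filtration M F n) : P.weylAct F w u ∈ filtration M F n :=
  map_mem_filtration F _ hu

theorem weylAct_mem_nonZeroDivisors (w : P.weylGroup) {d : FormalGroupRing M F}
    (hd : d ∈ nonZeroDivisors (FormalGroupRing M F)) :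
    P.weylAct F w d ∈ nonZeroDivisors (FormalGroupRing M F) := by
  refine mem_nonZeroDivisors_iff_left.mpr fun u hu => ?_
  have h := congrArg (P.weylAct F w⁻¹) hu
  rw [map_mul, ← weylAct_mul, inv_mul_cancel, weylAct_one, map_zero] at h
  have h' := congrArg (P.weylAct F w) (mem_nonZeroDivisors_iff_left.mp hd _ h)
  rwa [← weylAct_mul, mul_inv_cancel, weylAct_one, map_zero] at h'

theorem delta_mem_operatorAlgebra (i : ι) : P.delta F i ∈ P.operatorAlgebra F :=
  Algebra.subset_adjoin (Or.inl ⟨i, rfl⟩)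

theorem mem_ker_charMap {u : FormalGroupRing M F} : u ∈ LinearMap.ker (P.charMap F) ↔
    ∀ D ∈ P.operatorAlgebra F, aug M F (D u) = 0 := by
  rw [LinearMap.mem_ker]
  refine ⟨fun h D hD => ?_, fun h => LinearMap.ext ?_⟩
  · exact LinearMap.congr_fun h ⟨_, D, hD, rfl⟩
  · rintro ⟨_, D, hD, rfl⟩
    exact h D hD

variable [F.IsComm] [Module.Free ℤ M] (h2 : ∀ r : R, 2 * r = 0 → r = 0)
include h2

theorem isLeftRegular_x_root (i : ι) : IsLeftRegular (x F (P.root i)) :=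
  isLeftRegular_x (Module.Free.chooseBasis ℤ M) F h2 (P.toLinearMap.flip (P.coroot i))
    (P.root_coroot_two i)

theorem mul_delta (i : ι) (u : FormalGroupRing M F) :
    x F (P.root i) * P.delta F i u = u - P.weylAct F (weylGroup.ofIdx P i) u := by
  refine mul_dividedDifference _ (P.isLeftRegular_x_root F h2 i) (fun v => ?_) u
  refine x_dvd_sub_map (Module.Free.chooseBasis ℤ M) F h2 (P.toLinearMap.flip (P.coroot i))
    (P.root_coroot_two i) _ (fun l => ⟨P.toLinearMap l (P.coroot i), ?_⟩) v
  change l = _ + weylGroup.ofIdx P i • l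
  rw [ofIdx_smul_eq_sub, add_sub_cancel]

theorem delta_mul_of_invariant (i : ι) {a : FormalGroupRing M F}
    (ha : ∀ w, P.weylAct F w a = a) (u : FormalGroupRing M F) :
    P.delta F i (a * u) = a * P.delta F i u := by
  refine P.isLeftRegular_x_root F h2 i ?_
  change x F (P.root i) * _ = x F (P.root i) * _
  rw [mul_delta P F h2, mul_left_comm, mul_delta P F h2, map_mul, ha, mul_sub]

theorem operator_mul_of_invariant {D : Module.End R (FormalGroupRing M F)}
    (hD : D ∈ P.operatorAlgebra F) {a : FormalGroupRing M F}
    (ha : ∀ w, P.weylAct F w a = a) (u : FormalGroupRing M F) : D (a * u) = a * D u := by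
  induction hD using Algebra.adjoin_induction generalizing u with
  | mem D hD =>
    rcases hD with ⟨i, rfl⟩ | ⟨v, rfl⟩
    · exact P.delta_mul_of_invariant F h2 i ha u
    · exact mul_left_comm v a u
  | algebraMap r =>
    rw [Module.algebraMap_end_apply, Module.algebraMap_end_apply, mul_smul_comm]
  | add D D' _ _ h h' =>
    rw [LinearMap.add_apply, LinearMap.add_apply, h, h', mul_add]
  | mul D D' _ _ h h' =>
    rw [Module.End.mul_apply, Module.End.mul_apply, h', h]

theorem span_invariants_le_ker_charMap :
    (Ideal.span {u : FormalGroupRing M F | u ∈ augIdeal M F ∧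
      ∀ w : P.weylGroup, P.weylAct F w u = u}).restrictScalars R ≤ LinearMap.ker (P.charMap F) := by
  intro u hu
  rw [Submodule.restrictScalars_mem] at hu
  rw [mem_ker_charMap]
  intro D hD
  induction hu using Submodule.span_induction generalizing D with
  | mem a ha =>
    have h := P.operator_mul_of_invariant F h2 hD ha.2 1
    rw [mul_one] at h
    rw [h, map_mul, show aug M F a = 0 from ha.1, zero_mul]
  | zero => rw [map_zero, map_zero]
  | add a c _ _ ha hc => rw [map_add, map_add, ha D hD, hc D hD, add_zero]
  | smul r a _ ha =>
    -- The factor `r` is absorbed into the operator, which is why the induction runs over all `D`.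
    exact ha (D * LinearMap.mulLeft R r)
      (mul_mem hD (Algebra.subset_adjoin (Or.inr ⟨r, rfl⟩)))

end Delta

/-! ### Words of divided differences and their leading forms. -/

section Word

variable {ι M N R : Type*} [AddCommGroup M] [AddCommGroup N] [CommRing R]
  {P : RootDatum ι M N} (b : P.Base) (F : FormalGroup R)

/-- The composition `Δ_{i_1} ∘ ⋯ ∘ Δ_{i_l}` on the formal group ring. -/
noncomputable def deltaWord (I : List b.support) : Module.End R (FormalGroupRing M F) :=
  (I.map fun i => P.delta F (i : ι)).prod

@[simp] theorem deltaWord_nil : deltaWord b F [] = 1 := rfl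

@[simp] theorem deltaWord_cons (i : b.support) (I : List b.support) :
    deltaWord b F (i :: I) = P.delta F (i : ι) * deltaWord b F I := by
  simp [deltaWord]

theorem deltaWord_append (I J : List b.support) :
    deltaWord b F (I ++ J) = deltaWord b F I * deltaWord b F J := by
  simp [deltaWord]

theorem deltaWord_mem_operatorAlgebra (I : List b.support) :
    deltaWord b F I ∈ P.operatorAlgebra F := by
  induction I with
  | nil => exact one_mem _
  | cons i I ih =>
    rw [deltaWord_cons]
    exact mul_mem (P.delta_mem_operatorAlgebra F i) ih

/-- The algebra map from the symmetric algebra extending `lin`. -/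
noncomputable def symLift {κ : Type*} (e : Module.Basis κ ℤ M) :
    SymmetricAlgebra ℤ M →ₐ[ℤ] FormalGroupRing M F :=
  SymmetricAlgebra.lift (lin F e)

section SymLift

variable {κ : Type*} (e : Module.Basis κ ℤ M)

@[simp] theorem symLift_ι (m : M) : symLift F e (SymmetricAlgebra.ι ℤ M m) = lin F e m :=
  SymmetricAlgebra.lift_ι_apply _ _

variable [F.IsComm]

theorem symLift_mem_filtration {n : ℕ} {a : SymmetricAlgebra ℤ M}
    (ha : a ∈ LinearMap.range (SymmetricAlgebra.ι ℤ M) ^ n) :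
    symLift F e a ∈ filtration M F n := by
  induction n generalizing a with
  | zero => simp [filtration_zero]
  | succ n ih =>
    rw [pow_succ'] at ha
    refine Submodule.mul_induction_on ha ?_ ?_
    · rintro _ ⟨m, rfl⟩ c hc
      rw [map_mul, symLift_ι, add_comm]
      exact mul_mem_filtration F (lin_mem_filtration F e m) (ih hc)
    · intro u v hu hv
      rw [map_add]
      exact add_mem hu hv

theorem weylAct_lin_sub_mem (w : P.weylGroup) (m : M) :
    P.weylAct F w (lin F e m) - lin F e (w • m) ∈ filtration M F 2 := by
  have h1 := P.weylAct_mem_filtration F w (x_sub_lin_mem F e m)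
  rw [map_sub, weylAct_x] at h1
  convert sub_mem (x_sub_lin_mem F e (w • m)) h1 using 1
  ring

theorem weylAct_symLift_sub_mem (i : ι) {n : ℕ} {a : SymmetricAlgebra ℤ M}
    (ha : a ∈ LinearMap.range (SymmetricAlgebra.ι ℤ M) ^ n) :
    P.weylAct F (weylGroup.ofIdx P i) (symLift F e a) - symLift F e (P.symReflection i a) ∈
      filtration M F (n + 1) := by
  induction n generalizing a with
  | zero =>
    rw [pow_zero, Submodule.mem_one] at ha
    obtain ⟨z, rfl⟩ := ha
    simp
  | succ n ih =>
    rw [pow_succ'] at ha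
    refine Submodule.mul_induction_on ha ?_ ?_
    · rintro _ ⟨m, rfl⟩ c hc
      rw [map_mul, map_mul, map_mul, map_mul, symReflection_ι, symLift_ι, symLift_ι]
      have h1 := mul_mem_filtration F (weylAct_lin_sub_mem F e (weylGroup.ofIdx P i) m)
        (P.weylAct_mem_filtration F (weylGroup.ofIdx P i) (symLift_mem_filtration F e hc))
      have h3 := mul_mem_filtration F (lin_mem_filtration F e (weylGroup.ofIdx P i • m)) (ih hc)
      rw [show 2 + n = n + 1 + 1 by ring] at h1
      rw [show 1 + (n + 1) = n + 1 + 1 by ring] at h3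
      convert add_mem h1 h3 using 1
      ring
    · intro u v hu hv
      rw [map_add, map_add, map_add, map_add, add_sub_add_comm]
      exact add_mem hu hv

variable [Module.Free ℤ M] [Finite ι] (h2 : ∀ r : R, 2 * r = 0 → r = 0)
include h2

/-- After multiplication by `x_α` both sides become differences `u - s_α(u)` up to higher terms;
cancelling `x_α` costs one degree. -/
theorem delta_sub_symLift_mem (i : ι) {n : ℕ} {a : SymmetricAlgebra ℤ M}
    (ha : a ∈ LinearMap.range (SymmetricAlgebra.ι ℤ M) ^ (n + 1)) {u : FormalGroupRing M F}
    (hu : u - symLift F e a ∈ filtration M F (n + 1 + 1)) :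
    P.delta F i u - symLift F e (P.symDelta i a) ∈ filtration M F (n + 1) := by
  refine mem_filtration_of_x_mul_mem e F h2 (P.toLinearMap.flip (P.coroot i))
    (P.root_coroot_two i) ?_
  have h1 := P.weylAct_mem_filtration F (weylGroup.ofIdx P i) hu
  have h3 := weylAct_symLift_sub_mem (P := P) F e i ha
  have h4 := mul_mem_filtration F (x_sub_lin_mem F e (P.root i))
    (symLift_mem_filtration F e (P.symDelta_mem_pow i n ha))
  rw [show 2 + n = n + 1 + 1 by ring] at h4
  have h5 := congrArg (symLift F e) (P.mul_symDelta i a)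
  rw [map_mul, map_sub, symLift_ι] at h5
  rw [map_sub] at h1
  convert sub_mem (sub_mem (sub_mem hu h1) h3) h4 using 1
  rw [mul_sub, mul_delta P F h2]
  linear_combination -h5

theorem deltaWord_sub_symLift_mem (I : List b.support) {n : ℕ} {a : SymmetricAlgebra ℤ M}
    (ha : a ∈ LinearMap.range (SymmetricAlgebra.ι ℤ M) ^ (n + I.length))
    {u : FormalGroupRing M F} (hu : u - symLift F e a ∈ filtration M F (n + I.length + 1)) :
    symDeltaWord b I a ∈ LinearMap.range (SymmetricAlgebra.ι ℤ M) ^ n ∧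
      deltaWord b F I u - symLift F e (symDeltaWord b I a) ∈ filtration M F (n + 1) := by
  induction I generalizing n with
  | nil => exact ⟨ha, hu⟩
  | cons i I ih =>
    rw [List.length_cons, show n + (I.length + 1) = n + 1 + I.length by omega] at ha hu
    obtain ⟨h1, h3⟩ := ih ha hu
    rw [symDeltaWord_cons, deltaWord_cons, Module.End.mul_apply, Module.End.mul_apply]
    refine ⟨P.symDelta_mem_pow i n h1, ?_⟩
    exact delta_sub_symLift_mem (P := P) (a := symDeltaWord b I a) (u := deltaWord b F I u)
      F e h2 i h1 h3

end SymLift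

/-- Clearing the denominators `x_α` and their conjugates puts divided differences in the span of `W`
without passing to a localization. -/
theorem exists_mul_deltaWord_eq_sum [F.IsComm] [Module.Free ℤ M] [Fintype P.weylGroup]
    (h2 : ∀ r : R, 2 * r = 0 → r = 0) (I : List b.support) :
    ∃ d ∈ nonZeroDivisors (FormalGroupRing M F), ∃ c : P.weylGroup → FormalGroupRing M F,
      ∀ u, d * deltaWord b F I u = ∑ w, c w * P.weylAct F w u := by
  classical
  induction I with
  | nil =>
    refine ⟨1, one_mem _, fun w => if w = 1 then 1 else 0, fun u => ?_⟩
    simp [weylAct_one]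
  | cons i I ih =>
    obtain ⟨d, hd, c, hc⟩ := ih
    set s := weylGroup.ofIdx P (i : ι)
    have hx : x F (P.root i) ∈ nonZeroDivisors (FormalGroupRing M F) :=
      mem_nonZeroDivisors_iff_left.mpr
        (isLeftRegular_iff_right_eq_zero_of_mul.mp (P.isLeftRegular_x_root F h2 i))
    refine ⟨d * P.weylAct F s d * x F (P.root i),
      mul_mem (mul_mem hd (P.weylAct_mem_nonZeroDivisors F s hd)) hx,
      fun w => P.weylAct F s d * c w - d * P.weylAct F s (c (s⁻¹ * w)), fun u => ?_⟩
    have h1 : P.weylAct F s d * P.weylAct F s (deltaWord b F I u) =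
        ∑ w, P.weylAct F s (c (s⁻¹ * w)) * P.weylAct F w u := by
      rw [← map_mul, hc, map_sum, ← Equiv.sum_comp (Equiv.mulLeft s⁻¹)]
      refine Finset.sum_congr rfl fun w _ => ?_
      rw [map_mul, ← weylAct_mul, Equiv.coe_mulLeft, mul_inv_cancel_left]
    rw [deltaWord_cons, Module.End.mul_apply, mul_assoc, mul_delta P F h2]
    simp only [sub_mul, Finset.sum_sub_distrib, mul_assoc, ← Finset.mul_sum]
    rw [← hc, ← h1]
    ring

end Word

/-! ### The invertible matrix and the kernel of the characteristic map. -/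

section Basis

variable {ι M N R : Type*} [AddCommGroup M] [AddCommGroup N] [CommRing R]
  {P : RootDatum ι M N} {b : P.Base} (F : FormalGroup R) [F.IsComm] [Module.Free ℤ M] [Finite ι]
  [P.IsReduced] (h2 : ∀ r : R, 2 * r = 0 → r = 0)
include h2

/-- A word shorter than `N` leaves positive degree, which `ε` kills. A word of length `N` acts as
the one for `w₀` if its product is `w₀`; otherwise, as the longest element is unique, it is not
reduced and acts by zero. -/
theorem aug_deltaWord_eq {κ : Type*} (e : Module.Basis κ ℤ M) {I : List b.support}
    (hI : IsReducedLongest b I) {a : SymmetricAlgebra ℤ M}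
    (ha : a ∈ LinearMap.range (SymmetricAlgebra.ι ℤ M) ^ I.length) {t : ℤ}
    (hat : symDeltaWord b I a = algebraMap ℤ _ t) (J : List b.support) (hJ : J.length ≤ I.length) :
    aug M F (deltaWord b F J (symLift F e a)) =
      open Classical in if J.length = I.length ∧ wordProd b J = wordProd b I then (t : R) else 0 := by
  obtain ⟨n, hn⟩ := Nat.exists_eq_add_of_le' hJ
  obtain ⟨h1, h3⟩ := deltaWord_sub_symLift_mem b F e h2 J (hn ▸ ha)
    (u := symLift F e a) (by simp)
  have h4 := (mem_filtration_one F).mp (filtration_anti F (Nat.le_add_left 1 n) h3)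
  rw [map_sub, sub_eq_zero] at h4
  rw [h4]
  split_ifs with h
  · rw [symDeltaWord_congr b h.1 h.2, hat]
    simp
  · by_cases hl : J.length = I.length
    · have hw : wordProd b J ≠ wordProd b I := fun hw => h ⟨hl, hw⟩
      have hlt : weylLength b (wordProd b J) < J.length := by
        refine lt_of_le_of_ne (weylLength_wordProd_le b J) fun he => hw ?_
        exact eq_of_weylLength_eq b hI.2 (by rw [he, hl, hI.1])
      rw [symDeltaWord_eq_zero b hlt]
      simp
    · refine (mem_filtration_one F).mp (filtration_anti F ?_ (symLift_mem_filtration F e h1))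
      omega

/-- The matrix of the values `Δ_v Δ_w(u)`, with respect to suitable reduced decompositions, is
invertible when `u` lifts an element with invertible image under `Δ_{w₀}`. -/
theorem exists_isUnit_det_deltaWord [Fintype P.weylGroup] [DecidableEq P.weylGroup]
    {I : List b.support} (hI : IsReducedLongest b I) (ht : IsUnit (torsionIndex b : R)) :
    ∃ (J : P.weylGroup → List b.support) (c : P.weylGroup → FormalGroupRing M F),
      IsUnit (Matrix.of fun v w => deltaWord b F (J v) (c w)).det := by
  let e := Module.Free.chooseBasis ℤ M
  obtain ⟨a, ha, hat⟩ := exists_symDeltaWord_eq_torsionIndex b hI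
  choose J hJ hJ' using exists_reduced_word b
  set w₀ := wordProd b I
  -- The word `J v ++ J (w⁻¹ * w₀)` has length `N + ℓ(v) - ℓ(w)`, and its product is `w₀` exactly
  -- when `v = w`.
  let c : P.weylGroup → FormalGroupRing M F :=
    fun w => deltaWord b F (J (w⁻¹ * w₀)) (symLift F e a)
  refine ⟨J, c, isUnit_of_isUnit_aug F ?_⟩
  set G : Matrix P.weylGroup P.weylGroup (FormalGroupRing M F) :=
    Matrix.of fun v w => deltaWord b F (J v) (c w)
  have hdet : aug M F G.det = ((aug M F).toRingHom.mapMatrix G).det :=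
    RingHom.map_det (aug M F).toRingHom G
  have hlen : ∀ w, (J (w⁻¹ * w₀)).length + weylLength b w = I.length := by
    intro w
    rw [hJ, weylLength_inv_mul b hI.2, hI.1]
  have hG : ∀ v w, weylLength b v ≤ weylLength b w →
      (aug M F).toRingHom.mapMatrix G v w = if v = w then (torsionIndex b : R) else 0 := by
    intro v w hvw
    change aug M F (deltaWord b F (J v) (deltaWord b F (J (w⁻¹ * w₀)) (symLift F e a))) = _
    have hl := hlen w
    rw [← Module.End.mul_apply, ← deltaWord_append, aug_deltaWord_eq F h2 e hI ha hat _ (by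
      rw [List.length_append, hJ v]
      omega)]
    rw [wordProd_append, hJ', hJ', Int.cast_natCast, List.length_append, hJ v]
    by_cases h : v = w
    · subst h
      rw [if_pos ⟨by omega, mul_inv_cancel_left _ _⟩, if_pos rfl]
    · rw [if_neg h, if_neg]
      rintro ⟨-, h'⟩
      rw [← mul_assoc, mul_eq_right, mul_inv_eq_one] at h'
      exact h h'
  -- Entries vanish for `ℓ(v) < ℓ(w)`, whence the reversed order on lengths.
  have htri : ((aug M F).toRingHom.mapMatrix G).BlockTriangular
      (fun v => OrderDual.toDual (weylLength b v)) := by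
    intro v w hvw
    have hlt : weylLength b v < weylLength b w := hvw
    rw [hG v w hlt.le, if_neg]
    rintro rfl
    exact lt_irrefl _ hlt
  rw [hdet, htri.det]
  refine Finset.prod_induction _ IsUnit (fun _ _ => IsUnit.mul) isUnit_one fun k _ => ?_
  have hblock : ((aug M F).toRingHom.mapMatrix G).toSquareBlock
      (fun v => OrderDual.toDual (weylLength b v)) k = Matrix.diagonal fun _ => (torsionIndex b : R) := by
    ext ⟨v, hv⟩ ⟨w, hw⟩
    have hvw : weylLength b v = weylLength b w := OrderDual.toDual.injective (hv.trans hw.symm)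
    rw [Matrix.toSquareBlock_def, Matrix.of_apply, hG v w hvw.le, Matrix.diagonal_apply]
    simp only [Subtype.mk.injEq]
  rw [hblock, Matrix.det_diagonal]
  exact Finset.prod_induction _ IsUnit (fun _ _ => IsUnit.mul) isUnit_one fun _ _ => ht

theorem ker_charMap_le_span_invariants {I : List b.support} (hI : IsReducedLongest b I)
    (ht : IsUnit (torsionIndex b : R)) :
    LinearMap.ker (P.charMap F) ≤ (Ideal.span {u : FormalGroupRing M F | u ∈ augIdeal M F ∧
      ∀ w : P.weylGroup, P.weylAct F w u = u}).restrictScalars R := by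
  classical
  have : Finite P.weylGroup := finite_weylGroup b hI.2
  have := Fintype.ofFinite P.weylGroup
  intro u hu
  rw [mem_ker_charMap] at hu
  obtain ⟨J, c, hG⟩ := exists_isUnit_det_deltaWord F h2 hI ht
  set G := Matrix.of fun v w => deltaWord b F (J v) (c w) with hGdef
  choose d hd C hC using fun v => exists_mul_deltaWord_eq_sum b F h2 (J v)
  let V : Matrix P.weylGroup P.weylGroup (FormalGroupRing M F) :=
    Matrix.of fun v w => P.weylAct F v (c w)
  -- The same coefficients `C` express every `Δ_{J_v}` through `W`. Since `det G` is a unit and the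
  -- `d v` are nonzerodivisors, neither `det C` nor `det V` is a zero divisor.
  have hmat : Matrix.diagonal d * G = Matrix.of C * V := by
    ext v w
    rw [Matrix.diagonal_mul, Matrix.mul_apply]
    exact hC v (c w)
  have hdet : (Matrix.of C).det * V.det ∈ nonZeroDivisors (FormalGroupRing M F) := by
    rw [← Matrix.det_mul, ← hmat, Matrix.det_mul, Matrix.det_diagonal]
    exact mul_mem (prod_mem fun v _ => hd v) hG.mem_nonZeroDivisors
  rw [mul_mem_nonZeroDivisors] at hdet
  let y : P.weylGroup → FormalGroupRing M F := fun v => deltaWord b F (J v) u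
  let a := G⁻¹.mulVec y
  have hGa : G.mulVec a = y := by
    rw [Matrix.mulVec_mulVec, Matrix.mul_nonsing_inv _ hG, Matrix.one_mulVec]
  have hVa : V.mulVec a = fun w => P.weylAct F w u := by
    refine Matrix.mulVec_injective_of_det_mem_nonZeroDivisors hdet.1 ?_
    rw [Matrix.mulVec_mulVec, ← hmat, ← Matrix.mulVec_mulVec, hGa]
    ext v
    rw [Matrix.mulVec_diagonal]
    exact hC v u
  -- Applying `s` to the equation of index `s⁻¹w` shows that `s(a)` solves the same system `V a =
  -- (w(u))_w`, whose solution is unique.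
  have hinv : ∀ s v, P.weylAct F s (a v) = a v := by
    intro s
    refine congrFun (Matrix.mulVec_injective_of_det_mem_nonZeroDivisors hdet.2
      (a₁ := fun v => P.weylAct F s (a v)) (a₂ := a) ?_)
    rw [hVa]
    ext w
    have h := congrArg (P.weylAct F s) (congrFun hVa (s⁻¹ * w))
    rw [← weylAct_mul, mul_inv_cancel_left] at h
    rw [← h, Matrix.mulVec_eq_sum, Matrix.mulVec_eq_sum]
    simp [V, ← weylAct_mul]
  -- The vector `a` is `G⁻¹` applied to the `Δ_{J_v} u`, which lie in `I_F` because `u` is in the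
  -- kernel.
  have hmem : ∀ v, a v ∈ augIdeal M F := by
    intro v
    refine sum_mem fun w _ => Ideal.mul_mem_left _ _ ?_
    exact hu _ (deltaWord_mem_operatorAlgebra b F (J w))
  have hua : u = ∑ v, c v * a v := by
    have h := congrFun hVa 1
    rw [weylAct_one] at h
    rw [← h]
    simp [Matrix.mulVec, dotProduct, V, weylAct_one]
  rw [Submodule.restrictScalars_mem, hua]
  exact sum_mem fun v _ => Ideal.mul_mem_left _ _
    (Ideal.subset_span ⟨hmem v, fun w => hinv w v⟩)

end Basis

/-- Without a reduced longest word no generators exist, and the trivial subgroup of `ℤ` has index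
`0`. This disposes of that case without a proof that lengths are bounded. -/
theorem torsionIndex_eq_zero {ι M N : Type*} [AddCommGroup M] [AddCommGroup N]
    {P : RootDatum ι M N} {b : P.Base} (h : ∀ I, ¬ IsReducedLongest b I) : torsionIndex b = 0 := by
  have hbot : torsionSubgroup b = ⊥ := by
    rw [torsionSubgroup, ← AddSubgroup.closure_empty]
    congr 1
    refine Set.eq_empty_of_forall_notMem ?_
    rintro t ⟨I, hI, -⟩
    exact h I hI
  rw [torsionIndex, hbot, AddSubgroup.index_bot, Nat.card_eq_zero_of_infinite]

end RootPairing

theorem mainTheorem2 {ι M N R : Type*} [Finite ι] [AddCommGroup M] [AddCommGroup N]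
    [Module.Free ℤ M] [Module.Finite ℤ M] (P : RootDatum ι M N) [P.IsReduced] (b : P.Base)
    [CommRing R] (F : FormalGroup R) [F.IsComm]
    (ht : IsUnit (RootPairing.torsionIndex b : R))
    (h2 : ∀ r : R, 2 * r = 0 → r = 0) :
    LinearMap.ker (P.charMap F) =
      (Ideal.span {u : FormalGroupRing M F | u ∈ FormalGroupRing.augIdeal M F ∧
        ∀ w : P.weylGroup, P.weylAct F w u = u}).restrictScalars R := by
  refine le_antisymm ?_ (P.span_invariants_le_ker_charMap F h2)
  by_cases h : ∃ I, RootPairing.IsReducedLongest b I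
  · obtain ⟨I, hI⟩ := h
    exact RootPairing.ker_charMap_le_span_invariants F h2 hI ht
  -- Here `0` is invertible in `R`, so all modules over `R` are trivial.
  · rw [RootPairing.torsionIndex_eq_zero (not_exists.mp h), Nat.cast_zero,
      isUnit_zero_iff] at ht
    have := subsingleton_of_zero_eq_one ht
    have := Module.subsingleton R (FormalGroupRing M F)
    exact fun u _ => by rw [Subsingleton.elim u 0]; exact zero_mem _
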